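/- Let $p$ be a prime and let $L$ be a $\mathbb{Z}_p$-Lie algebra which is free of rank $3$ as a $\mathbb{Z}_p$-module. For a finite-index sublattice $\Lambda$ of a free $\mathbb{Z}_p$-module $M$ of rank $3$ write $M/\Lambda\cong\bigoplus_{j=1}^{3}\mathbb{Z}_p/I_j$ with nonzero ideals $I_1\subseteq I_2\subseteq I_3$, and put $\alpha_j(\Lambda)=|\mathbb{Z}_p/I_j|$. For $\mathbf{s}=(s_1,s_2,s_3)\in\mathbb{C}^3$ let $$\zeta^{\mathrm{co}}_{\mathbb{Z}_p^3}(\mathbf{s})=\sum_{\Lambda\subseteq\mathbb{Z}_p^3}\prod_{j=1}^{3}\alpha_j(\Lambda)^{-s_j},\qquad \zeta^{\mathrm{co}}_{p^iL}(\mathbf{s})=\sum_{\Lambda\le p^iL}\prod_{j=1}^{3}\alpha_j(\Lambda)^{-s_j},$$ where the first sum is over all finite-index $\mathbb{Z}_p$-sublattices of $\mathbb{Z}_p^3$, and the second over all finite-index $\mathbb{Z}_p$-Lie subalgebras of the Lie algebra $p^iL$ $(i\ge 0)$. For a $\mathbb{Z}_p$-basis $(e_1,e_2,e_3)$ of $L$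 let $A$ be the $3\times3$ matrix over $\mathbb{Z}_p$ whose rows are the coordinate vectors of $[e_2,e_3]$, $[e_3,e_1]$, $[e_1,e_2]$. A ternary quadratic form $f$ over $\mathbb{Z}_p$ is said to be attached to $L$ if $f(\mathbf{x})=\mathbf{x}^{t}A\mathbf{x}$ for some such basis. Call $f,g$ equivalent if $g(\mathbf{x})=u\,f(P\mathbf{x})$ for some $u\in\mathbb{Z}_p^{\times}$ and $P\in\mathrm{GL}_3(\mathbb{Z}_p)$. Let $Z_f(s)=\int_{\mathbb{Z}_p^3}|f(\mathbf{x})|_p^{s}\,d\mu$ be Igusa's local zeta function, where $\mu$ is the Haar measure on $\mathbb{Z}_p^3$ with $\mu(\mathbb{Z}_p^3)=1$. **Theorem.** There is a ternary quadratic form attached to $L$, and it is unique up to equivalence: if $f$ is attached to $L$, then a form $g$ is attached to $L$ if and only if it is equivalent to $f$. If $f$ is attached to $L$, then for every $i\ge0$ and all $s_1,s_2,s_3\in\mathbb{C}$ with $\mathrm{Re}(s_1)>2$, $\mathrm{Re}(s_1+s_2)>2$ and $\mathrm{Re}(s_1+s_2+s_3)>0$, the series $\zeta^{\mathrm{co}}_{\mathbb{Z}_p^3}(\mathbf{s})$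 and $\zeta^{\mathrm{co}}_{p^iL}(\mathbf{s})$ converge absolutely, the integral $Z_f(s_1-2)$ converges, and $$\zeta_{p^{i}L}^{\mathrm{co}}(\mathbf{s})=\zeta_{\mathbb{Z}_{p}^3}^{\mathrm{co}}(\mathbf{s})-\frac{Z_{f}(s_{1}-2)\,(p^{2-s_1})^{i+1}(1+p^{1-s_1-s_2})(1-p^{1-2s_1})}{(1-p^{2-s_1})(1-p^{2-s_1-s_2})(1-p^{2-2s_1-s_2-s_3})(1-p^{-1})}.$$ -/

import Mathlib

noncomputable section

open MeasureTheory

namespace CotypeZeta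

section Cotype

variable (R : Type*) [CommRing R]

/-- `HasCotype R M α`: there are nonzero ideals `I₁ ⊆ I₂ ⊆ ⋯ ⊆ I_d` of `R` with
`M ≅ R/I₁ ⊕ ⋯ ⊕ R/I_d` and `α_i = |R/I_i|`. -/
def HasCotype (M : Type*) [AddCommGroup M] [Module R M] {d : ℕ} (α : Fin d → ℕ) : Prop :=
  ∃ I : Fin d → Ideal R, Monotone I ∧ (∀ i, I i ≠ ⊥) ∧
    Nonempty (M ≃ₗ[R] ((i : Fin d) → R ⧸ I i)) ∧ ∀ i, α i = Nat.card (R ⧸ I i)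

/-- The cotype `(α₁, …, α_d)` of a sublattice `Λ` of an `R`-module `L` of rank `d`,
read off from the elementary divisor decomposition of `L/Λ`. -/
def cotype {L : Type*} [AddCommGroup L] [Module R L] (d : ℕ) (Λ : Submodule R L) : Fin d → ℕ :=
  Classical.epsilon (HasCotype R (L ⧸ Λ))

/-- The monomial `α₁(Λ)^{-s₁} ⋯ α_d(Λ)^{-s_d}`. -/
def cotypeTerm {L : Type*} [AddCommGroup L] [Module R L] {d : ℕ} (s : Fin d → ℂ)
    (Λ : Submodule R L) : ℂ :=
  ∏ i, (cotype R d Λ i : ℂ) ^ (-(s i))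

/-- The `R`-sublattices of finite index in `R^d`. -/
abbrev FiniteIndexSublattice (d : ℕ) : Type _ :=
  {Λ : Submodule R (Fin d → R) // Finite ((Fin d → R) ⧸ Λ)}

/-- The `R`-subalgebras of finite index in the `R`-Lie algebra `L`. -/
abbrev FiniteIndexSubalgebra (L : Type*) [LieRing L] [LieAlgebra R L] : Type _ :=
  {Λ : LieSubalgebra R L // Finite (L ⧸ Λ.toSubmodule)}

/-- The cotype zeta function of `R^d`. -/
def latticeCotypeZeta {d : ℕ} (s : Fin d → ℂ) : ℂ :=
  ∑' Λ : FiniteIndexSublattice R d, cotypeTerm R s Λ.1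

/-- The subalgebra cotype zeta function of an `R`-Lie algebra `L` of rank `d`. -/
def subalgebraCotypeZeta (L : Type*) [LieRing L] [LieAlgebra R L] {d : ℕ} (s : Fin d → ℂ) : ℂ :=
  ∑' Λ : FiniteIndexSubalgebra R L, cotypeTerm R s Λ.1.toSubmodule

variable {R} in
/-- The `R`-Lie algebra `aL = {a x : x ∈ L}`, with the bracket of `L`. -/
def scaled (a : R) (L : Type*) [LieRing L] [LieAlgebra R L] : LieSubalgebra R L where
  toSubmodule := LinearMap.range (LinearMap.lsmul R L a)
  lie_mem' := by
    rintro _ _ ⟨x, rfl⟩ ⟨y, rfl⟩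
    exact ⟨⁅x, a • y⁆, by simp⟩

end Cotype

section Form

variable {R : Type*} [CommRing R] {L : Type*} [LieRing L] [LieAlgebra R L]

/-- The matrix of structure constants with respect to a basis `(e₁, e₂, e₃)`: its rows are the
coordinates of `[e₂, e₃]`, `[e₃, e₁]`, `[e₁, e₂]`. -/
def structureMatrix (b : Module.Basis (Fin 3) R L) : Matrix (Fin 3) (Fin 3) R :=
  Matrix.of ![⇑(b.repr ⁅b 1, b 2⁆), ⇑(b.repr ⁅b 2, b 0⁆), ⇑(b.repr ⁅b 0, b 1⁆)]

/-- The ternary quadratic form `f(x) = xᵗ A x`, where `A` is the matrix of structure constants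
with respect to the given basis. -/
def basisForm (b : Module.Basis (Fin 3) R L) : QuadraticForm R (Fin 3 → R) :=
  (Matrix.toBilin' (structureMatrix b)).toQuadraticMap

/-- `f` is a ternary quadratic form attached to `L`: it is `xᵗ A x` for the matrix `A` of structure
constants of `L` with respect to some basis of `L`. -/
def IsAttachedForm (L : Type*) [LieRing L] [LieAlgebra R L]
    (f : QuadraticForm R (Fin 3 → R)) : Prop :=
  ∃ b : Module.Basis (Fin 3) R L, f = basisForm b

/-- Equivalence (similarity) of quadratic forms: up to an invertible linear change of variables and
multiplication by a unit of `R`. -/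
def FormEquiv {d : ℕ} (f g : QuadraticForm R (Fin d → R)) : Prop :=
  ∃ (u : Rˣ) (e : (Fin d → R) ≃ₗ[R] (Fin d → R)), ∀ x, g x = u * f (e x)

end Form

section Igusa

variable (p : ℕ) [Fact p.Prime]

instance : MeasurableSpace ℤ_[p] := borel _

instance : BorelSpace ℤ_[p] := ⟨rfl⟩

/-- The additive Haar measure on `ℤ_p^d` with total mass `1`. -/
def padicHaar (d : ℕ) : Measure (Fin d → ℤ_[p]) := Measure.addHaarMeasure ⊤

/-- Igusa's local zeta function `Z_f(s) = ∫_{ℤ_p^d} |f(x)|_p^s dμ` of (the polynomial function)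
`f` on `ℤ_p^d`. -/
def igusaZeta {d : ℕ} (f : (Fin d → ℤ_[p]) → ℤ_[p]) (s : ℂ) : ℂ :=
  ∫ x, ((‖f x‖ : ℝ) : ℂ) ^ s ∂(padicHaar p d)

end Igusa

end CotypeZeta

end

/-!
In coordinates on `p ^ i L` the subalgebras of finite index are the lattices `Λ ⊆ ℤ_p ^ 3` closed
under a bracket, so the difference of the two zeta functions is the sum over the lattices that are
not closed. By the elementary divisor theorem each `Λ` has a type `(c, l, m)`, meaning elementary
divisors `p ^ (c + l + m)`, `p ^ (c + l)`, `p ^ c` along some basis `x₁, x₂, x₃`. As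
`[x₂, x₃]` is the only bracket of basis vectors that can obstruct closure, `Λ` is a subalgebra
exactly when `p ^ m` divides `p ^ c f(ξ)`, where `f` is the form attached to `p ^ i L` and `ξ` is
the functional dual to `x₁` (`HasType.isBracketClosed_iff`). This uses that, up to the determinant
of a change of basis, `f` is a quadratic form on the dual of the Lie algebra (`basisForm_vecMul`),
which also gives the uniqueness of attached forms up to equivalence.

The lattices are counted by volumes. A lattice of type `(c, l, m)` is recovered from a primitive
functional `ξ` and a primitive vector `x` with `p ^ m ∣ ξ x`, as `p ^ c (ℤ_p x + p ^ l H)` with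
`H = {z | p ^ m ∣ ξ z}` (`HasType.mem_iff`). The pairs `(ξ, x)` belonging to one lattice form a
product set whose volume depends only on the type, the product sets of different lattices are
disjoint, and for `m > 0` they exhaust all pairs. Hence the number of lattices of a given type
whose functionals lie in a set `S` is an explicit multiple of the volume of the primitive vectors
in `S` (`ncard_hasType_mul_eq`), and without any condition it is at most a constant times
`p ^ (2 l + 2 m)`, which gives absolute convergence.

Summing over `m` turns the volumes of `{ξ | ¬ p ^ m ∣ p ^ c f(ξ)}` into the integral of
`|f| ^ (s₁ - 2)` over primitive vectors (`hasSum_measureReal_not_dvd`), which is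
`(1 - p ^ (1 - 2 s₁)) Z_f(s₁ - 2)` by the substitution `x ↦ p x`. The sums over `l` and `c` are
geometric series. Finally, the form attached to `p ^ i L` is `p ^ i` times the one attached to
`L`, whence the power of `p ^ (2 - s₁)`.
-/

noncomputable section

open MeasureTheory

namespace CotypeZeta

/-! ### Diagonal lattices and the uniqueness of the cotype -/

section Lattices

variable {p : ℕ} [Fact p.Prime]

/-- The diagonal sublattice `p ^ n₁ ℤ_p ⊕ ⋯ ⊕ p ^ n_d ℤ_p` of `ℤ_p ^ d`. -/
def diagLattice (p : ℕ) [Fact p.Prime] {d : ℕ} (n : Fin d → ℕ) :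
    Submodule ℤ_[p] (Fin d → ℤ_[p]) :=
  Submodule.pi Set.univ fun j => Ideal.span {(p : ℤ_[p]) ^ n j}

lemma mem_diagLattice {d : ℕ} {n : Fin d → ℕ} {x : Fin d → ℤ_[p]} :
    x ∈ diagLattice p n ↔ ∀ j, (p : ℤ_[p]) ^ n j ∣ x j := by
  simp [diagLattice, Submodule.mem_pi, Ideal.mem_span_singleton]

/-- The lattice with elementary divisors `p ^ n_j` along the dual basis given by the rows of the
invertible matrix `Q`. -/
def adaptedLattice {d : ℕ} (Q : GL (Fin d) ℤ_[p]) (n : Fin d → ℕ) :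
    Submodule ℤ_[p] (Fin d → ℤ_[p]) :=
  (diagLattice p n).comap (Matrix.mulVecLin (Q : Matrix (Fin d) (Fin d) ℤ_[p]))

lemma mem_adaptedLattice {d : ℕ} {Q : GL (Fin d) ℤ_[p]} {n : Fin d → ℕ} {x : Fin d → ℤ_[p]} :
    x ∈ adaptedLattice Q n ↔
      ∀ j, (p : ℤ_[p]) ^ n j ∣ ((Q : Matrix (Fin d) (Fin d) ℤ_[p]).mulVec x) j := by
  simp [adaptedLattice, mem_diagLattice]

lemma card_quotient_span_pow (n : ℕ) :
    Nat.card (ℤ_[p] ⧸ Ideal.span {(p : ℤ_[p]) ^ n}) = p ^ n := by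
  rw [← PadicInt.ker_toZModPow]
  have h := RingHom.quotientKerEquivOfSurjective (f := PadicInt.toZModPow (p := p) n)
    (ZMod.ringHom_surjective _)
  rw [Nat.card_congr h.toEquiv, Nat.card_zmod]

/-- `ℤ_p ^ d` modulo the lattice adapted to `Q` is a sum of cyclic modules. -/
def quotientAdaptedEquiv {d : ℕ} (Q : GL (Fin d) ℤ_[p]) (n : Fin d → ℕ) :
    ((Fin d → ℤ_[p]) ⧸ adaptedLattice Q n) ≃ₗ[ℤ_[p]]
      ((j : Fin d) → ℤ_[p] ⧸ Ideal.span {(p : ℤ_[p]) ^ n j}) :=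
  (Submodule.quotEquivOfEq _ _ (by
    ext x
    simp only [mem_adaptedLattice, LinearMap.mem_ker]
    simp only [LinearMap.coe_comp, Function.comp_apply, Matrix.mulVecLin_apply, funext_iff,
      LinearMap.pi_apply, LinearMap.proj_apply, Pi.zero_apply, Submodule.mkQ_apply,
      Submodule.Quotient.mk_eq_zero, Ideal.mem_span_singleton])).trans
  (LinearMap.quotKerEquivOfSurjective
    ((LinearMap.pi fun j => (Ideal.span {(p : ℤ_[p]) ^ n j}).mkQ ∘ₗ LinearMap.proj j) ∘ₗ
      Matrix.mulVecLin (Q : Matrix (Fin d) (Fin d) ℤ_[p])) (by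
    intro y
    choose x hx using fun j => Submodule.mkQ_surjective (Ideal.span {(p : ℤ_[p]) ^ n j}) (y j)
    refine ⟨((Q⁻¹ : GL (Fin d) ℤ_[p]) : Matrix (Fin d) (Fin d) ℤ_[p]).mulVec x, ?_⟩
    ext j
    simp only [LinearMap.coe_comp, Function.comp_apply, Matrix.mulVecLin_apply,
      Matrix.mulVec_mulVec, LinearMap.pi_apply, LinearMap.proj_apply]
    rw [← Units.val_mul, mul_inv_cancel, Units.val_one, Matrix.one_mulVec, hx]))

lemma card_quotient_adaptedLattice {d : ℕ} (Q : GL (Fin d) ℤ_[p]) (n : Fin d → ℕ) :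
    Nat.card ((Fin d → ℤ_[p]) ⧸ adaptedLattice Q n) = p ^ ∑ j, n j := by
  rw [Nat.card_congr (quotientAdaptedEquiv Q n).toEquiv, Nat.card_pi]
  simp_rw [card_quotient_span_pow, Finset.prod_pow_eq_pow_sum]

lemma adaptedLattice_one {d : ℕ} (n : Fin d → ℕ) :
    adaptedLattice (1 : GL (Fin d) ℤ_[p]) n = diagLattice p n := by
  ext x; simp [mem_adaptedLattice, mem_diagLattice]

lemma card_quotient_diagLattice {d : ℕ} (n : Fin d → ℕ) :
    Nat.card ((Fin d → ℤ_[p]) ⧸ diagLattice p n) = p ^ ∑ j, n j := by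
  rw [← adaptedLattice_one, card_quotient_adaptedLattice]

lemma p_pow_ne_zero (k : ℕ) : (p : ℤ_[p]) ^ k ≠ 0 :=
  pow_ne_zero _ (by exact_mod_cast (Fact.out : p.Prime).ne_zero)

/-- The orders of the submodules `p ^ k N` recover the truncated sums of the exponents of `N`. -/
lemma card_range_lsmul_pow {N : Type*} [AddCommGroup N] [Module ℤ_[p] N] {d : ℕ} {n : Fin d → ℕ}
    (e : N ≃ₗ[ℤ_[p]] ((j : Fin d) → ℤ_[p] ⧸ Ideal.span {(p : ℤ_[p]) ^ n j})) (k : ℕ) :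
    Nat.card (LinearMap.range (LinearMap.lsmul ℤ_[p] N ((p : ℤ_[p]) ^ k))) =
      p ^ ∑ j, (n j - k) := by
  set π : (Fin d → ℤ_[p]) →ₗ[ℤ_[p]] N := e.symm.toLinearMap ∘ₗ
    LinearMap.pi (fun j => (Ideal.span {(p : ℤ_[p]) ^ n j}).mkQ ∘ₗ LinearMap.proj j) with hπ
  have hsurj : Function.Surjective π := by
    refine e.symm.surjective.comp fun y => ?_
    choose x hx using fun j => Submodule.mkQ_surjective (Ideal.span {(p : ℤ_[p]) ^ n j}) (y j)
    exact ⟨x, funext hx⟩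
  set ψ := LinearMap.lsmul ℤ_[p] N ((p : ℤ_[p]) ^ k) ∘ₗ π with hψ
  have hr : LinearMap.range ψ = LinearMap.range (LinearMap.lsmul ℤ_[p] N ((p : ℤ_[p]) ^ k)) :=
    LinearMap.range_comp_of_range_eq_top _ (LinearMap.range_eq_top.2 hsurj)
  have hk : LinearMap.ker ψ = diagLattice p fun j => n j - k := by
    ext x
    rw [LinearMap.mem_ker, mem_diagLattice]
    have : ψ x = e.symm (LinearMap.pi
        (fun j => (Ideal.span {(p : ℤ_[p]) ^ n j}).mkQ ∘ₗ LinearMap.proj j)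
          ((p : ℤ_[p]) ^ k • x)) := by
      simp [hψ, hπ]
    rw [this, LinearEquiv.map_eq_zero_iff]
    simp only [LinearMap.coe_comp, Function.comp_apply, funext_iff,
      LinearMap.pi_apply, LinearMap.proj_apply, Pi.zero_apply, Submodule.mkQ_apply,
      Submodule.Quotient.mk_eq_zero, Ideal.mem_span_singleton, Pi.smul_apply, smul_eq_mul]
    refine forall_congr' fun j => ?_
    rcases le_total (n j) k with h | h
    · simp [Nat.sub_eq_zero_of_le h, (pow_dvd_pow (p : ℤ_[p]) h).mul_right]
    · rw [← Nat.add_sub_cancel' h, pow_add, mul_dvd_mul_iff_left (p_pow_ne_zero k)]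
      simp
  rw [← hr, Nat.card_congr (ψ.quotKerEquivRange).symm.toEquiv, hk, card_quotient_diagLattice]

lemma HasCotype.exists_exponents {N : Type*} [AddCommGroup N] [Module ℤ_[p] N] {d : ℕ}
    {α : Fin d → ℕ} (h : HasCotype ℤ_[p] N α) :
    ∃ n : Fin d → ℕ, Antitone n ∧ α = (fun j => p ^ n j) ∧
      Nonempty (N ≃ₗ[ℤ_[p]] ((j : Fin d) → ℤ_[p] ⧸ Ideal.span {(p : ℤ_[p]) ^ n j})) := by
  obtain ⟨I, hI, h0, ⟨e⟩, hα⟩ := h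
  choose n hn using fun j => PadicInt.ideal_eq_span_pow_p (h0 j)
  obtain rfl : I = fun j => Ideal.span {(p : ℤ_[p]) ^ n j} := funext hn
  refine ⟨n, fun i j hij => ?_, ?_, ⟨e⟩⟩
  · have := hI hij
    rw [Ideal.span_singleton_le_span_singleton] at this
    exact (pow_dvd_pow_iff (by exact_mod_cast (Fact.out : p.Prime).ne_zero)
      PadicInt.prime_p.not_isUnit).1 this
  · funext j
    rw [hα, card_quotient_span_pow]

/-- The cotype is well defined, so `Classical.epsilon` in its definition makes no choice. -/
lemma HasCotype.unique {N : Type*} [AddCommGroup N] [Module ℤ_[p] N]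
    {α β : Fin 3 → ℕ} (h : HasCotype ℤ_[p] N α) (h' : HasCotype ℤ_[p] N β) : α = β := by
  obtain ⟨n, hn, rfl, ⟨e⟩⟩ := h.exists_exponents
  obtain ⟨m, hm, rfl, ⟨e'⟩⟩ := h'.exists_exponents
  have key : ∀ k, ∑ j, (n j - k) = ∑ j, (m j - k) := fun k =>
    Nat.pow_right_injective (Fact.out : p.Prime).two_le
      ((card_range_lsmul_pow e k).symm.trans (card_range_lsmul_pow e' k))
  simp only [Fin.sum_univ_three] at key
  have a1 := hn (show (0 : Fin 3) ≤ 1 by decide)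
  have a2 := hn (show (1 : Fin 3) ≤ 2 by decide)
  have a3 := hm (show (0 : Fin 3) ≤ 1 by decide)
  have a4 := hm (show (1 : Fin 3) ≤ 2 by decide)
  have k0 := key 0
  have k1 := key (n 0)
  have k2 := key (m 0)
  have k3 := key (n 1)
  have k4 := key (m 1)
  have : n = m := by
    funext j
    fin_cases j <;> simp <;> omega
  rw [this]

lemma hasCotype_adaptedLattice {d : ℕ} (Q : GL (Fin d) ℤ_[p]) {n : Fin d → ℕ} (hn : Antitone n) :
    HasCotype ℤ_[p] ((Fin d → ℤ_[p]) ⧸ adaptedLattice Q n) fun j => p ^ n j :=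
  ⟨fun j => Ideal.span {(p : ℤ_[p]) ^ n j},
    fun _ _ hij => (Ideal.span_singleton_le_span_singleton).2 (pow_dvd_pow _ (hn hij)),
    fun j => by simpa only [Ne, Ideal.span_singleton_eq_bot] using p_pow_ne_zero (n j),
    ⟨quotientAdaptedEquiv Q n⟩, fun j => (card_quotient_span_pow _).symm⟩

lemma cotype_adaptedLattice (Q : GL (Fin 3) ℤ_[p]) {n : Fin 3 → ℕ} (hn : Antitone n) :
    cotype ℤ_[p] 3 (adaptedLattice Q n) = fun j => p ^ n j :=
  (Classical.epsilon_spec ⟨_, hasCotype_adaptedLattice Q hn⟩ :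
    HasCotype ℤ_[p] _ (Classical.epsilon _)).unique (hasCotype_adaptedLattice Q hn)

end Lattices

/-! ### Elementary divisors of lattices in rank three -/

section ElementaryDivisors

variable {p : ℕ} [Fact p.Prime]

/-- The exponents `(c + l + m, c + l, c)`; every triple of decreasing exponents has this form. -/
def exponents (t : ℕ × ℕ × ℕ) : Fin 3 → ℕ := ![t.1 + t.2.1 + t.2.2, t.1 + t.2.1, t.1]

/-- `Λ` has elementary divisors `p ^ (c + l + m)`, `p ^ (c + l)`, `p ^ c`, where `t = (c, l, m)`. -/
def HasType (Λ : Submodule ℤ_[p] (Fin 3 → ℤ_[p])) (t : ℕ × ℕ × ℕ) : Prop :=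
  ∃ Q : GL (Fin 3) ℤ_[p], Λ = adaptedLattice Q (exponents t)

lemma antitone_exponents (t : ℕ × ℕ × ℕ) : Antitone (exponents t) := by
  refine Fin.antitone_iff_succ_le.2 fun i => ?_
  fin_cases i <;> simp [exponents]

lemma exponents_injective : Function.Injective exponents := by
  rintro ⟨a, b, c⟩ ⟨a', b', c'⟩ h
  have h0 := congrFun h 0
  have h1 := congrFun h 1
  have h2 := congrFun h 2
  simp [exponents] at h0 h1 h2
  simp only [Prod.mk.injEq]
  omega

lemma HasType.cotype_eq {Λ : Submodule ℤ_[p] (Fin 3 → ℤ_[p])} {t : ℕ × ℕ × ℕ}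
    (h : HasType Λ t) : cotype ℤ_[p] 3 Λ = fun j => p ^ exponents t j := by
  obtain ⟨Q, rfl⟩ := h
  exact cotype_adaptedLattice Q (antitone_exponents t)

lemma HasType.unique {Λ : Submodule ℤ_[p] (Fin 3 → ℤ_[p])} {t t' : ℕ × ℕ × ℕ}
    (h : HasType Λ t) (h' : HasType Λ t') : t = t' := by
  refine exponents_injective (funext fun j => ?_)
  exact Nat.pow_right_injective (Fact.out : p.Prime).two_le
    (congrFun (h.cotype_eq.symm.trans h'.cotype_eq) j)

/-- The coordinate matrix of a basis of `ℤ_p ^ d`. -/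
def coordMatrix {d : ℕ} (b : Module.Basis (Fin d) ℤ_[p] (Fin d → ℤ_[p])) : GL (Fin d) ℤ_[p] where
  val := LinearMap.toMatrix' b.equivFun.toLinearMap
  inv := LinearMap.toMatrix' b.equivFun.symm.toLinearMap
  val_inv := by rw [← LinearMap.toMatrix'_comp]; simp
  inv_val := by rw [← LinearMap.toMatrix'_comp]; simp

lemma coordMatrix_mulVec {d : ℕ} (b : Module.Basis (Fin d) ℤ_[p] (Fin d → ℤ_[p]))
    (x : Fin d → ℤ_[p]) :
    (coordMatrix b : Matrix (Fin d) (Fin d) ℤ_[p]).mulVec x = b.repr x := by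
  change (LinearMap.toMatrix' b.equivFun.toLinearMap).mulVec x = _
  rw [LinearMap.toMatrix'_mulVec]
  rfl

lemma finrank_eq_of_finite_quotient {d : ℕ} (Λ : Submodule ℤ_[p] (Fin d → ℤ_[p]))
    [Finite ((Fin d → ℤ_[p]) ⧸ Λ)] : Module.finrank ℤ_[p] Λ = d := by
  have h := Submodule.finrank_quotient_add_finrank Λ
  have h0 : Module.finrank ℤ_[p] ((Fin d → ℤ_[p]) ⧸ Λ) = 0 := by
    rw [Module.finrank_eq_zero_iff]
    intro x
    refine ⟨(Nat.card ((Fin d → ℤ_[p]) ⧸ Λ) : ℤ_[p]), ?_, ?_⟩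
    · exact_mod_cast Nat.card_pos.ne'
    · rw [Nat.cast_smul_eq_nsmul]
      exact card_nsmul_eq_zero'
  rw [h0, zero_add] at h
  simpa using h

/-- The elementary divisor theorem over `ℤ_p`, with the exponents in decreasing order. -/
lemma exists_adaptedLattice_eq {d : ℕ} (Λ : Submodule ℤ_[p] (Fin d → ℤ_[p]))
    [Finite ((Fin d → ℤ_[p]) ⧸ Λ)] :
    ∃ (Q : GL (Fin d) ℤ_[p]) (n : Fin d → ℕ), Antitone n ∧ Λ = adaptedLattice Q n := by
  obtain ⟨b, a, b', hb⟩ := Submodule.exists_smith_normal_form_of_rank_eq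
    (Pi.basisFun ℤ_[p] (Fin d)) (N := Λ) (by rw [finrank_eq_of_finite_quotient]; simp)
  have ha : ∀ i, a i ≠ 0 := by
    intro i h0
    refine b'.ne_zero i (Subtype.ext ?_)
    rw [hb, h0, zero_smul]; rfl
  have hmem : ∀ x, x ∈ Λ ↔ ∀ i, a i ∣ b.repr x i := by
    intro x
    constructor
    · intro hx i
      have := congrArg (Submodule.subtype Λ) (b'.sum_repr ⟨x, hx⟩)
      simp only [map_sum, map_smul, Submodule.subtype_apply, hb] at this
      rw [← this]
      refine ⟨b'.repr ⟨x, hx⟩ i, ?_⟩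
      simp [Finsupp.single_apply, mul_comm]
    · intro h
      choose c hc using h
      rw [← b.sum_repr x]
      refine Submodule.sum_mem _ fun i _ => ?_
      rw [hc, mul_comm, mul_smul, ← hb]
      exact Λ.smul_mem _ (b' i).2
  set n : Fin d → ℕ := fun i => (a i).valuation
  set σ := Tuple.sort (fun i => OrderDual.toDual (n i))
  refine ⟨coordMatrix (b.reindex σ.symm), n ∘ σ, fun i j hij =>
    Tuple.monotone_sort (fun i => OrderDual.toDual (n i)) hij, ?_⟩
  ext x
  rw [hmem, mem_adaptedLattice, coordMatrix_mulVec, ← σ.forall_congr_right]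
  refine forall_congr' fun i => ?_
  have : Associated (a (σ i)) ((p : ℤ_[p]) ^ n (σ i)) := by
    refine Associated.symm ⟨PadicInt.unitCoeff (ha (σ i)), ?_⟩
    rw [mul_comm]
    exact (PadicInt.unitCoeff_spec (ha (σ i))).symm
  rw [this.dvd_iff_dvd_left]
  simp [Module.Basis.repr_reindex]

lemma exists_hasType (Λ : FiniteIndexSublattice ℤ_[p] 3) : ∃ t, HasType Λ.1 t := by
  obtain ⟨Λ, hΛ⟩ := Λ
  obtain ⟨Q, n, hn, h⟩ := exists_adaptedLattice_eq Λ
  refine ⟨(n 2, n 1 - n 2, n 0 - n 1), Q, ?_⟩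
  have h1 := hn (show (0 : Fin 3) ≤ 1 by decide)
  have h2 := hn (show (1 : Fin 3) ≤ 2 by decide)
  refine h.trans (congrArg (adaptedLattice Q) ?_)
  ext j
  fin_cases j <;> simp [exponents] <;> omega

/-- The triple `(c, l, m)` such that `Λ` has elementary divisors
`p ^ (c + l + m)`, `p ^ (c + l)`, `p ^ c`. -/
def latticeType (Λ : FiniteIndexSublattice ℤ_[p] 3) : ℕ × ℕ × ℕ := (exists_hasType Λ).choose

lemma hasType_latticeType (Λ : FiniteIndexSublattice ℤ_[p] 3) : HasType Λ.1 (latticeType Λ) :=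
  (exists_hasType Λ).choose_spec

lemma latticeType_eq_iff {Λ : FiniteIndexSublattice ℤ_[p] 3} {t : ℕ × ℕ × ℕ} :
    latticeType Λ = t ↔ HasType Λ.1 t :=
  ⟨fun h => h ▸ hasType_latticeType Λ, fun h => (hasType_latticeType Λ).unique h⟩

lemma HasType.finite {Λ : Submodule ℤ_[p] (Fin 3 → ℤ_[p])} {t : ℕ × ℕ × ℕ}
    (h : HasType Λ t) : Finite ((Fin 3 → ℤ_[p]) ⧸ Λ) := by
  obtain ⟨Q, rfl⟩ := h
  refine Nat.finite_of_card_ne_zero ?_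
  rw [card_quotient_adaptedLattice]
  exact pow_ne_zero _ (Fact.out : p.Prime).ne_zero

end ElementaryDivisors

/-! ### Lattices and flags of primitive vectors -/

section Flags

variable {p : ℕ} [Fact p.Prime]

lemma mem_diagLattice_const {d k : ℕ} {x : Fin d → ℤ_[p]} :
    x ∈ diagLattice p (fun _ => k) ↔ ∃ z, x = (p : ℤ_[p]) ^ k • z := by
  rw [mem_diagLattice]
  constructor
  · intro h
    choose z hz using h
    exact ⟨z, funext hz⟩
  · rintro ⟨z, rfl⟩ j
    exact dvd_mul_right _ _

/-- Vectors with some unit coordinate. -/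
def IsPrimitive {d : ℕ} (x : Fin d → ℤ_[p]) : Prop := x ∉ diagLattice p (fun _ => 1)

lemma isPrimitive_iff_exists {d : ℕ} {x : Fin d → ℤ_[p]} :
    IsPrimitive x ↔ ∃ j, IsUnit (x j) := by
  rw [IsPrimitive, mem_diagLattice]
  push Not
  refine exists_congr fun j => ?_
  rw [pow_one, ← Ideal.mem_span_singleton, ← PadicInt.maximalIdeal_eq_span_p,
    IsLocalRing.mem_maximalIdeal, mem_nonunits_iff, not_not]

lemma mulVec_mem_diagLattice_const {d k : ℕ} (Q : GL (Fin d) ℤ_[p]) {x : Fin d → ℤ_[p]} :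
    (Q : Matrix (Fin d) (Fin d) ℤ_[p]).mulVec x ∈ diagLattice p (fun _ => k) ↔
      x ∈ diagLattice p (fun _ => k) := by
  simp only [mem_diagLattice_const]
  constructor
  · rintro ⟨z, hz⟩
    refine ⟨((Q⁻¹ : GL (Fin d) ℤ_[p]) : Matrix (Fin d) (Fin d) ℤ_[p]).mulVec z, ?_⟩
    rw [← Matrix.mulVec_smul, ← hz, Matrix.mulVec_mulVec, ← Units.val_mul, inv_mul_cancel,
      Units.val_one, Matrix.one_mulVec]
  · rintro ⟨z, rfl⟩
    exact ⟨_, Matrix.mulVec_smul _ _ _⟩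

lemma vecMul_mem_diagLattice_const {d k : ℕ} (Q : GL (Fin d) ℤ_[p]) {x : Fin d → ℤ_[p]} :
    Matrix.vecMul x (Q : Matrix (Fin d) (Fin d) ℤ_[p]) ∈ diagLattice p (fun _ => k) ↔
      x ∈ diagLattice p (fun _ => k) := by
  simp only [mem_diagLattice_const]
  constructor
  · rintro ⟨z, hz⟩
    refine ⟨Matrix.vecMul z ((Q⁻¹ : GL (Fin d) ℤ_[p]) : Matrix (Fin d) (Fin d) ℤ_[p]), ?_⟩
    rw [← Matrix.smul_vecMul, ← hz, Matrix.vecMul_vecMul, ← Units.val_mul, mul_inv_cancel,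
      Units.val_one, Matrix.vecMul_one]
  · rintro ⟨z, rfl⟩
    exact ⟨_, Matrix.smul_vecMul _ _ _⟩

lemma mulVec_inv_mulVec {d : ℕ} (Q : GL (Fin d) ℤ_[p]) (x : Fin d → ℤ_[p]) :
    (Q : Matrix (Fin d) (Fin d) ℤ_[p]).mulVec
      (((Q⁻¹ : GL (Fin d) ℤ_[p]) : Matrix (Fin d) (Fin d) ℤ_[p]).mulVec x) = x := by
  rw [Matrix.mulVec_mulVec, ← Units.val_mul, mul_inv_cancel, Units.val_one, Matrix.one_mulVec]

lemma vecMul_inv_dotProduct_mulVec {d : ℕ} (Q : GL (Fin d) ℤ_[p]) (ξ x : Fin d → ℤ_[p]) :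
    dotProduct (Matrix.vecMul ξ ((Q⁻¹ : GL (Fin d) ℤ_[p]) : Matrix (Fin d) (Fin d) ℤ_[p]))
      ((Q : Matrix (Fin d) (Fin d) ℤ_[p]).mulVec x) = dotProduct ξ x := by
  rw [← Matrix.dotProduct_mulVec, Matrix.mulVec_mulVec, ← Units.val_mul, inv_mul_cancel,
    Units.val_one, Matrix.one_mulVec]

/-- For a lattice `Λ` of type `(c, l, m)`, the primitive functionals `ξ` such that
`{y | p ^ m ∣ ξ y}` is the hyperplane lattice determined by `Λ`. -/
def dualVectors (t : ℕ × ℕ × ℕ) (Λ : Submodule ℤ_[p] (Fin 3 → ℤ_[p])) : Set (Fin 3 → ℤ_[p]) :=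
  {ξ | IsPrimitive ξ ∧ ∀ y ∈ Λ, y ∈ diagLattice p (fun _ : Fin 3 => t.1 + t.2.1) →
    (p : ℤ_[p]) ^ (t.1 + t.2.1 + t.2.2) ∣ dotProduct ξ y}

/-- For a lattice `Λ` of type `(c, l, m)`, the primitive vectors `x` with `p ^ c x ∈ Λ`. -/
def lineVectors (t : ℕ × ℕ × ℕ) (Λ : Submodule ℤ_[p] (Fin 3 → ℤ_[p])) : Set (Fin 3 → ℤ_[p]) :=
  {x | IsPrimitive x ∧ (p : ℤ_[p]) ^ t.1 • x ∈ Λ}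

lemma mem_lineVectors_adaptedLattice {t : ℕ × ℕ × ℕ} {Q : GL (Fin 3) ℤ_[p]}
    {x : Fin 3 → ℤ_[p]} :
    x ∈ lineVectors t (adaptedLattice Q (exponents t)) ↔
      (Q : Matrix (Fin 3) (Fin 3) ℤ_[p]).mulVec x ∈
        (diagLattice p ![t.2.1 + t.2.2, t.2.1, 0] : Set (Fin 3 → ℤ_[p])) \
          (diagLattice p (fun _ : Fin 3 => 1) : Set (Fin 3 → ℤ_[p])) := by
  rw [lineVectors, Set.mem_ofPred_eq, IsPrimitive, ← mulVec_mem_diagLattice_const Q, and_comm,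
    Set.mem_sdiff, SetLike.mem_coe, SetLike.mem_coe]
  refine and_congr_left fun _ => ?_
  rw [mem_adaptedLattice, mem_diagLattice, Matrix.mulVec_smul]
  simp only [Fin.forall_fin_succ, exponents, Pi.smul_apply, smul_eq_mul]
  simp [add_assoc, pow_add _ t.1, mul_dvd_mul_iff_left (p_pow_ne_zero (p := p) t.1)]

lemma mem_dualVectors_adaptedLattice {t : ℕ × ℕ × ℕ} {Q : GL (Fin 3) ℤ_[p]}
    {ξ : Fin 3 → ℤ_[p]} :
    ξ ∈ dualVectors t (adaptedLattice Q (exponents t)) ↔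
      Matrix.vecMul ξ ((Q⁻¹ : GL (Fin 3) ℤ_[p]) : Matrix (Fin 3) (Fin 3) ℤ_[p]) ∈
        (diagLattice p ![0, t.2.2, t.2.2] : Set (Fin 3 → ℤ_[p])) \
          (diagLattice p (fun _ : Fin 3 => 1) : Set (Fin 3 → ℤ_[p])) := by
  obtain ⟨c, l, m⟩ := t
  rw [dualVectors, Set.mem_ofPred_eq, IsPrimitive, ← vecMul_mem_diagLattice_const Q⁻¹, and_comm,
    Set.mem_sdiff, SetLike.mem_coe, SetLike.mem_coe]
  refine and_congr_left fun _ => ?_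
  have key : ∀ y, dotProduct ξ y = _ := fun y => (vecMul_inv_dotProduct_mulVec Q ξ y).symm
  simp only [key]
  set η := Matrix.vecMul ξ ((Q⁻¹ : GL (Fin 3) ℤ_[p]) : Matrix (Fin 3) (Fin 3) ℤ_[p])
  rw [mem_diagLattice]
  constructor
  · intro h
    have hz : ∀ z : Fin 3 → ℤ_[p], (p : ℤ_[p]) ^ m ∣ z 0 →
        (p : ℤ_[p]) ^ m ∣ dotProduct η z := by
      intro z h0
      have := h (((Q⁻¹ : GL (Fin 3) ℤ_[p]) : Matrix (Fin 3) (Fin 3) ℤ_[p]).mulVec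
        ((p : ℤ_[p]) ^ (c + l) • z)) ?_ ?_
      · rw [mulVec_inv_mulVec, dotProduct_smul, smul_eq_mul, pow_add _ (c + l),
          mul_dvd_mul_iff_left (p_pow_ne_zero _)] at this
        exact this
      · rw [mem_adaptedLattice, mulVec_inv_mulVec]
        intro j
        fin_cases j
        · simpa [exponents, pow_add _ (c + l)] using mul_dvd_mul_left _ h0
        · simp [exponents]
        · simp [exponents, pow_add, mul_assoc]
      · rw [mulVec_mem_diagLattice_const, mem_diagLattice_const]
        exact ⟨z, rfl⟩
    intro j
    fin_cases j
    · simp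
    · simpa [dotProduct, Fin.sum_univ_three] using hz ![0, 1, 0] (by simp)
    · simpa [dotProduct, Fin.sum_univ_three] using hz ![0, 0, 1] (by simp)
  · intro h y hy hy'
    rw [← mulVec_mem_diagLattice_const Q, mem_diagLattice] at hy'
    rw [mem_adaptedLattice] at hy
    set w := (Q : Matrix (Fin 3) (Fin 3) ℤ_[p]).mulVec y
    have a0 := hy 0
    have a1 := hy' 1
    have a2 := hy' 2
    have b1 := h 1
    have b2 := h 2
    simp [exponents] at a0 a1 a2 b1 b2
    rw [dotProduct, Fin.sum_univ_three]
    refine dvd_add (dvd_add (a0.mul_left _) ?_) ?_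
    · rw [mul_comm, pow_add]; exact mul_dvd_mul a1 b1
    · rw [mul_comm, pow_add]; exact mul_dvd_mul a2 b2

lemma dualVectors_dvd_dotProduct {t : ℕ × ℕ × ℕ} {Λ : Submodule ℤ_[p] (Fin 3 → ℤ_[p])}
    {ξ x : Fin 3 → ℤ_[p]} (hξ : ξ ∈ dualVectors t Λ) (hx : x ∈ lineVectors t Λ) :
    (p : ℤ_[p]) ^ t.2.2 ∣ dotProduct ξ x := by
  have := hξ.2 ((p : ℤ_[p]) ^ (t.1 + t.2.1) • x)
    (by rw [add_comm, pow_add, mul_smul]; exact Λ.smul_mem _ hx.2)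
    (mem_diagLattice_const.2 ⟨x, rfl⟩)
  rwa [dotProduct_smul, smul_eq_mul, pow_add, mul_dvd_mul_iff_left (p_pow_ne_zero _)] at this

/-- A lattice of type `(c, l, m)` is `p ^ c (ℤ_p x + p ^ l H)`, where `x` is any of its line vectors
and `H = {z | p ^ m ∣ ξ z}` for any of its dual vectors `ξ`. -/
lemma HasType.mem_iff {t : ℕ × ℕ × ℕ} {Λ : Submodule ℤ_[p] (Fin 3 → ℤ_[p])} (hΛ : HasType Λ t)
    {ξ x : Fin 3 → ℤ_[p]} (hξ : ξ ∈ dualVectors t Λ) (hx : x ∈ lineVectors t Λ)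
    (y : Fin 3 → ℤ_[p]) :
    y ∈ Λ ↔ ∃ (r : ℤ_[p]) (z : Fin 3 → ℤ_[p]), (p : ℤ_[p]) ^ t.2.2 ∣ dotProduct ξ z ∧
      y = (p : ℤ_[p]) ^ t.1 • (r • x + (p : ℤ_[p]) ^ t.2.1 • z) := by
  have hx2 := hx.2
  obtain ⟨Q, rfl⟩ := hΛ
  obtain ⟨c, l, m⟩ := t
  rw [mem_lineVectors_adaptedLattice] at hx
  rw [mem_dualVectors_adaptedLattice] at hξ
  simp only at hx2 ⊢
  have key : ∀ z, dotProduct ξ z = _ := fun z => (vecMul_inv_dotProduct_mulVec Q ξ z).symm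
  simp only [key]
  set η := Matrix.vecMul ξ ((Q⁻¹ : GL (Fin 3) ℤ_[p]) : Matrix (Fin 3) (Fin 3) ℤ_[p])
  obtain ⟨hη, hη1⟩ := hξ
  obtain ⟨hw, hw1⟩ := hx
  simp only [SetLike.mem_coe, mem_diagLattice, Fin.forall_fin_succ] at hη hw
  change IsPrimitive η at hη1
  change IsPrimitive ((Q : Matrix (Fin 3) (Fin 3) ℤ_[p]).mulVec x) at hw1
  rw [isPrimitive_iff_exists] at hη1 hw1
  have hp : ¬ IsUnit (p : ℤ_[p]) := PadicInt.prime_p.not_isUnit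
  constructor
  · intro hy
    rw [mem_adaptedLattice] at hy
    -- For `l = 0` take `r = 0`; for `l > 0` the last coordinate of `Q x` is a unit, and `r` is chosen
    -- to cancel the last coordinate.
    suffices ∃ (r : ℤ_[p]) (v : Fin 3 → ℤ_[p]), (p : ℤ_[p]) ^ m ∣ v 0 ∧
        (Q : Matrix (Fin 3) (Fin 3) ℤ_[p]).mulVec y = (p : ℤ_[p]) ^ c •
          (r • (Q : Matrix (Fin 3) (Fin 3) ℤ_[p]).mulVec x + (p : ℤ_[p]) ^ l • v) by
      obtain ⟨r, v, hv, h⟩ := this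
      refine ⟨r, ((Q⁻¹ : GL (Fin 3) ℤ_[p]) : Matrix (Fin 3) (Fin 3) ℤ_[p]).mulVec v, ?_, ?_⟩
      · rw [mulVec_inv_mulVec, dotProduct, Fin.sum_univ_three]
        simp at hη
        exact dvd_add (dvd_add (hv.mul_left _) (hη.1.mul_right _)) (hη.2.mul_right _)
      · have hinj : Function.Injective (Q : Matrix (Fin 3) (Fin 3) ℤ_[p]).mulVec :=
          Matrix.mulVec_injective_of_isUnit Q.isUnit
        apply hinj
        rw [h]
        simp [Matrix.mulVec_smul, Matrix.mulVec_add]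
    set w := (Q : Matrix (Fin 3) (Fin 3) ℤ_[p]).mulVec x
    set u := (Q : Matrix (Fin 3) (Fin 3) ℤ_[p]).mulVec y
    obtain ⟨u0, h0⟩ := hy 0
    obtain ⟨u1, h1⟩ := hy 1
    obtain ⟨u2, h2⟩ := hy 2
    simp [exponents] at h0 h1 h2
    rcases Nat.eq_zero_or_pos l with rfl | hl
    · refine ⟨0, ![(p : ℤ_[p]) ^ m * u0, u1, u2], by simp, ?_⟩
      funext j
      fin_cases j
      · simp [h0]; ring
      · simp [h1]
      · simp [h2]
    · simp at hw
      obtain ⟨⟨w0, hw0⟩, ⟨w1, hw1'⟩⟩ := hw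
      have hunit : IsUnit (w 2) := by
        obtain ⟨j, hj⟩ := hw1
        have hpl : ¬ IsUnit ((p : ℤ_[p]) ^ l) := by
          rw [isUnit_pow_iff hl.ne']; exact hp
        fin_cases j
        · simp only [Fin.zero_eta, hw0, pow_add, IsUnit.mul_iff] at hj
          exact absurd hj.1.1 hpl
        · simp only [Fin.mk_one, hw1', IsUnit.mul_iff] at hj
          exact absurd hj.1 hpl
        · exact hj
      obtain ⟨e, he⟩ := hunit
      refine ⟨↑e⁻¹ * u2, ![(p : ℤ_[p]) ^ m * (u0 - ↑e⁻¹ * u2 * w0), u1 - ↑e⁻¹ * u2 * w1, 0],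
        by simp, ?_⟩
      funext j
      fin_cases j
      · simp only [Fin.zero_eta, h0, Pi.smul_apply, Pi.add_apply, smul_eq_mul, hw0,
          Matrix.cons_val]
        ring
      · simp only [Fin.mk_one, h1, Pi.smul_apply, Pi.add_apply, smul_eq_mul, hw1',
          Matrix.cons_val]
        ring
      · have : (↑e⁻¹ : ℤ_[p]) * w 2 = 1 := by rw [← he]; simp
        simp only [Fin.reduceFinMk, h2, Pi.smul_apply, Pi.add_apply, smul_eq_mul]
        simp only [Matrix.cons_val]
        linear_combination (-(p : ℤ_[p]) ^ c * u2) * this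
  · rintro ⟨r, z, hz, rfl⟩
    rw [smul_add]
    refine Submodule.add_mem _ ?_ ?_
    · rw [smul_comm]; exact Submodule.smul_mem _ _ hx2
    · rw [mem_adaptedLattice]
      simp only [Matrix.mulVec_smul]
      set v := (Q : Matrix (Fin 3) (Fin 3) ℤ_[p]).mulVec z
      have hv : (p : ℤ_[p]) ^ m ∣ v 0 := by
        rcases Nat.eq_zero_or_pos m with rfl | hm
        · simp
        simp at hη
        have hpm : ¬ IsUnit ((p : ℤ_[p]) ^ m) := by
          rw [isUnit_pow_iff hm.ne']; exact hp
        have hunit : IsUnit (η 0) := by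
          obtain ⟨j, hj⟩ := hη1
          fin_cases j
          · exact hj
          · exact absurd (isUnit_of_dvd_unit hη.1 hj) hpm
          · exact absurd (isUnit_of_dvd_unit hη.2 hj) hpm
        rw [dotProduct, Fin.sum_univ_three, dvd_add_left (hη.2.mul_right _),
          dvd_add_left (hη.1.mul_right _), hunit.dvd_mul_left] at hz
        exact hz
      intro j
      fin_cases j
      · simpa [exponents, pow_add, mul_assoc] using
          mul_dvd_mul_left _ (mul_dvd_mul_left _ hv)
      · simp [exponents, pow_add, ← mul_assoc]
      · simp [exponents]

lemma HasType.eq_of_mem {t : ℕ × ℕ × ℕ} {Λ Λ' : Submodule ℤ_[p] (Fin 3 → ℤ_[p])}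
    (hΛ : HasType Λ t) (hΛ' : HasType Λ' t) {ξ x : Fin 3 → ℤ_[p]}
    (hξ : ξ ∈ dualVectors t Λ) (hx : x ∈ lineVectors t Λ)
    (hξ' : ξ ∈ dualVectors t Λ') (hx' : x ∈ lineVectors t Λ') : Λ = Λ' := by
  ext y
  rw [hΛ.mem_iff hξ hx, hΛ'.mem_iff hξ' hx']

/-- `GL_3(ℤ_p)` acts transitively on primitive vectors, here with the target `e₃`. -/
lemma exists_mulVec_eq_last {x : Fin 3 → ℤ_[p]} (hx : IsPrimitive x) :
    ∃ Q : GL (Fin 3) ℤ_[p], (Q : Matrix (Fin 3) (Fin 3) ℤ_[p]).mulVec x = ![0, 0, 1] := by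
  obtain ⟨j, u, hu⟩ := isPrimitive_iff_exists.1 hx
  have hinv : (↑u⁻¹ : ℤ_[p]) * x j = 1 := by rw [← hu]; simp
  suffices ∃ A : Matrix (Fin 3) (Fin 3) ℤ_[p], IsUnit A.det ∧ A.mulVec x = ![0, 0, 1] by
    obtain ⟨A, hA, h⟩ := this
    exact ⟨Matrix.GeneralLinearGroup.mk'' A hA, h⟩
  fin_cases j
  · refine ⟨!![-(↑u⁻¹ * x 1), 1, 0; -(↑u⁻¹ * x 2), 0, 1; ↑u⁻¹, 0, 0], ?_, ?_⟩
    · simp [Matrix.det_fin_three]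
    · replace hinv : (↑u⁻¹ : ℤ_[p]) * x 0 = 1 := hinv
      funext k
      fin_cases k <;> simp [Matrix.mulVec, dotProduct, Fin.sum_univ_three]
      · linear_combination (-x 1) * hinv
      · linear_combination (-x 2) * hinv
      · simpa using hinv
  · refine ⟨!![1, -(↑u⁻¹ * x 0), 0; 0, -(↑u⁻¹ * x 2), 1; 0, ↑u⁻¹, 0], ?_, ?_⟩
    · simp [Matrix.det_fin_three]
    · replace hinv : (↑u⁻¹ : ℤ_[p]) * x 1 = 1 := hinv
      funext k
      fin_cases k <;> simp [Matrix.mulVec, dotProduct, Fin.sum_univ_three]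
      · linear_combination (-x 0) * hinv
      · linear_combination (-x 2) * hinv
      · simpa using hinv
  · refine ⟨!![1, 0, -(↑u⁻¹ * x 0); 0, 1, -(↑u⁻¹ * x 1); 0, 0, ↑u⁻¹], ?_, ?_⟩
    · simp [Matrix.det_fin_three]
    · replace hinv : (↑u⁻¹ : ℤ_[p]) * x 2 = 1 := hinv
      funext k
      fin_cases k <;> simp [Matrix.mulVec, dotProduct, Fin.sum_univ_three]
      · linear_combination (-x 0) * hinv
      · linear_combination (-x 1) * hinv
      · simpa using hinv

/-- A primitive functional `ξ` and a primitive vector `x` with `p ^ m ∣ ξ x` come from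
some lattice of each type `(c, l, m)` with `m > 0`. -/
lemma exists_hasType_of_dvd_dotProduct {t : ℕ × ℕ × ℕ} (hm : 0 < t.2.2) {ξ x : Fin 3 → ℤ_[p]}
    (hξ : IsPrimitive ξ) (hx : IsPrimitive x) (h : (p : ℤ_[p]) ^ t.2.2 ∣ dotProduct ξ x) :
    ∃ Λ, HasType Λ t ∧ ξ ∈ dualVectors t Λ ∧ x ∈ lineVectors t Λ := by
  obtain ⟨g, hg⟩ := exists_mulVec_eq_last hx
  set η := Matrix.vecMul ξ ((g⁻¹ : GL (Fin 3) ℤ_[p]) : Matrix (Fin 3) (Fin 3) ℤ_[p]) with hη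
  have hη2 : (p : ℤ_[p]) ^ t.2.2 ∣ η 2 := by
    rw [← vecMul_inv_dotProduct_mulVec g, hg, ← hη] at h
    simpa [dotProduct, Fin.sum_univ_three] using h
  have hηp : IsPrimitive η := by
    rwa [IsPrimitive, hη, vecMul_mem_diagLattice_const]
  have hp : ¬ IsUnit ((p : ℤ_[p]) ^ t.2.2) := by
    rw [isUnit_pow_iff hm.ne']; exact PadicInt.prime_p.not_isUnit
  -- Reduce `η` to `(*, 0, η 2)` by a matrix fixing the last basis vector.
  obtain ⟨k, hk, hk1⟩ : ∃ k : GL (Fin 3) ℤ_[p],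
      (k : Matrix (Fin 3) (Fin 3) ℤ_[p]).mulVec ![0, 0, 1] = ![0, 0, 1] ∧
      Matrix.vecMul η (k : Matrix (Fin 3) (Fin 3) ℤ_[p]) ∈ diagLattice p ![0, t.2.2, t.2.2] := by
    suffices ∃ A : Matrix (Fin 3) (Fin 3) ℤ_[p], IsUnit A.det ∧
        A.mulVec ![0, 0, 1] = ![0, 0, 1] ∧
        Matrix.vecMul η A ∈ diagLattice p ![0, t.2.2, t.2.2] by
      obtain ⟨A, hA, h⟩ := this
      exact ⟨Matrix.GeneralLinearGroup.mk'' A hA, h⟩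
    obtain ⟨j, u, hu⟩ := isPrimitive_iff_exists.1 hηp
    have hinv : (↑u⁻¹ : ℤ_[p]) * η j = 1 := by rw [← hu]; simp
    fin_cases j
    · refine ⟨!![1, -(↑u⁻¹ * η 1), 0; 0, 1, 0; 0, 0, 1], ?_, ?_, ?_⟩
      · simp [Matrix.det_fin_three]
      · funext k
        fin_cases k <;> simp [Matrix.mulVec, dotProduct, Fin.sum_univ_three]
      · rw [mem_diagLattice]
        replace hinv : (↑u⁻¹ : ℤ_[p]) * η 0 = 1 := hinv
        have : η 0 * (↑u⁻¹ * η 1) = η 1 := by linear_combination η 1 * hinv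
        intro k
        fin_cases k
        · simp
        · simp [Matrix.vecMul, dotProduct, Fin.sum_univ_three, this]
        · simpa [Matrix.vecMul, dotProduct, Fin.sum_univ_three] using hη2
    · refine ⟨!![0, 1, 0; 1, -(↑u⁻¹ * η 0), 0; 0, 0, 1], ?_, ?_, ?_⟩
      · simp [Matrix.det_fin_three]
      · funext k
        fin_cases k <;> simp [Matrix.mulVec, dotProduct, Fin.sum_univ_three]
      · rw [mem_diagLattice]
        replace hinv : (↑u⁻¹ : ℤ_[p]) * η 1 = 1 := hinv
        have : η 1 * (↑u⁻¹ * η 0) = η 0 := by linear_combination η 0 * hinv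
        intro k
        fin_cases k
        · simp
        · simp [Matrix.vecMul, dotProduct, Fin.sum_univ_three, this]
        · simpa [Matrix.vecMul, dotProduct, Fin.sum_univ_three] using hη2
    · exact absurd (isUnit_of_dvd_unit hη2 ⟨u, hu⟩) hp
  have hQx : ((k⁻¹ * g : GL (Fin 3) ℤ_[p]) : Matrix (Fin 3) (Fin 3) ℤ_[p]).mulVec x =
      ![0, 0, 1] := by
    rw [Units.val_mul, ← Matrix.mulVec_mulVec, hg, ← hk, Matrix.mulVec_mulVec, ← Units.val_mul,
      inv_mul_cancel, Units.val_one, Matrix.one_mulVec, hk]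
  refine ⟨adaptedLattice (k⁻¹ * g) (exponents t), ⟨_, rfl⟩, ?_, ?_⟩
  · rw [mem_dualVectors_adaptedLattice, mul_inv_rev, inv_inv, Units.val_mul,
      ← Matrix.vecMul_vecMul]
    exact ⟨hk1, by rwa [SetLike.mem_coe, vecMul_mem_diagLattice_const]⟩
  · rw [mem_lineVectors_adaptedLattice]
    refine ⟨?_, ?_⟩
    · rw [hQx, SetLike.mem_coe, mem_diagLattice]
      intro j
      fin_cases j <;> simp
    · rw [SetLike.mem_coe, mulVec_mem_diagLattice_const]
      exact hx

end Flags

/-! ### Haar measure and the volume of the set of flags of a lattice -/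

section Measure

variable {p : ℕ} [Fact p.Prime]

instance isAddHaarMeasure_padicHaar (d : ℕ) : (padicHaar p d).IsAddHaarMeasure := by
  unfold padicHaar; infer_instance

instance isProbabilityMeasure_padicHaar (d : ℕ) : IsProbabilityMeasure (padicHaar p d) :=
  ⟨by
    have h := Measure.addHaarMeasure_self
      (K₀ := (⊤ : TopologicalSpace.PositiveCompacts (Fin d → ℤ_[p])))
    rwa [TopologicalSpace.PositiveCompacts.coe_top] at h⟩

lemma isClosed_setOf_pow_dvd (k : ℕ) : IsClosed {x : ℤ_[p] | (p : ℤ_[p]) ^ k ∣ x} := by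
  have : {x : ℤ_[p] | (p : ℤ_[p]) ^ k ∣ x} = {x | ‖x‖ ≤ (p : ℝ) ^ (-k : ℤ)} := by
    ext x
    rw [Set.mem_ofPred_eq, Set.mem_ofPred_eq, PadicInt.norm_le_pow_iff_mem_span_pow,
      Ideal.mem_span_singleton]
  rw [this]
  exact isClosed_le continuous_norm continuous_const

lemma measurableSet_diagLattice {d : ℕ} (n : Fin d → ℕ) :
    MeasurableSet (diagLattice p n : Set (Fin d → ℤ_[p])) := by
  have : (diagLattice p n : Set (Fin d → ℤ_[p])) =
      ⋂ j, (fun x : Fin d → ℤ_[p] => x j) ⁻¹' {x : ℤ_[p] | (p : ℤ_[p]) ^ n j ∣ x} := by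
    ext x; simp [mem_diagLattice]
  rw [this]
  exact (isClosed_iInter fun j =>
    (isClosed_setOf_pow_dvd _).preimage (continuous_apply j)).measurableSet

lemma measureReal_diagLattice {d : ℕ} (n : Fin d → ℕ) :
    (padicHaar p d).real (diagLattice p n : Set (Fin d → ℤ_[p])) = (p : ℝ)⁻¹ ^ ∑ j, n j := by
  have hidx : (diagLattice p n).toAddSubgroup.index = p ^ ∑ j, n j :=
    card_quotient_diagLattice n
  have hp : (p : ℝ) ≠ 0 := by exact_mod_cast (Fact.out : p.Prime).ne_zero
  have : (diagLattice p n).toAddSubgroup.FiniteIndex :=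
    ⟨by rw [hidx]; exact pow_ne_zero _ (Fact.out : p.Prime).ne_zero⟩
  have h := AddSubgroup.index_mul_measure (diagLattice p n).toAddSubgroup
    (measurableSet_diagLattice n) (padicHaar p d)
  rw [hidx, measure_univ] at h
  have h2 := congrArg ENNReal.toReal h
  rw [ENNReal.toReal_mul] at h2
  simp only [ENNReal.toReal_one, Nat.cast_pow] at h2
  rw [inv_pow]
  exact eq_inv_of_mul_eq_one_right h2

lemma measureReal_diagLattice_diff {d : ℕ} (n k : Fin d → ℕ) :
    (padicHaar p d).real ((diagLattice p n : Set (Fin d → ℤ_[p])) \ diagLattice p k) =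
      (p : ℝ)⁻¹ ^ (∑ j, n j) - (p : ℝ)⁻¹ ^ (∑ j, max (n j) (k j)) := by
  have hinter : (diagLattice p n : Set (Fin d → ℤ_[p])) ∩ diagLattice p k =
      diagLattice p fun j => max (n j) (k j) := by
    ext x
    simp only [Set.mem_inter_iff, SetLike.mem_coe, mem_diagLattice, ← forall_and]
    refine forall_congr' fun j => ?_
    rcases le_total (n j) (k j) with h | h
    · rw [max_eq_right h]
      exact ⟨fun a => a.2, fun a => ⟨(pow_dvd_pow _ h).trans a, a⟩⟩
    · rw [max_eq_left h]
      exact ⟨fun a => a.1, fun a => ⟨a, (pow_dvd_pow _ h).trans a⟩⟩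
  have h := measureReal_inter_add_sdiff (μ := padicHaar p d)
    (s := (diagLattice p n : Set (Fin d → ℤ_[p]))) (measurableSet_diagLattice k)
  rw [hinter] at h
  rw [← measureReal_diagLattice, ← measureReal_diagLattice]
  linarith

lemma measurePreserving_mulVec {d : ℕ} (Q : GL (Fin d) ℤ_[p]) :
    MeasurePreserving (fun x => (Q : Matrix (Fin d) (Fin d) ℤ_[p]).mulVec x)
      (padicHaar p d) (padicHaar p d) :=
  AddMonoidHom.measurePreserving
    (f := (Matrix.mulVecLin (Q : Matrix (Fin d) (Fin d) ℤ_[p])).toAddMonoidHom)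
    (Continuous.matrix_mulVec continuous_const continuous_id)
    (fun y => ⟨_, mulVec_inv_mulVec Q y⟩) rfl

lemma measurePreserving_vecMul {d : ℕ} (Q : GL (Fin d) ℤ_[p]) :
    MeasurePreserving (fun x => Matrix.vecMul x (Q : Matrix (Fin d) (Fin d) ℤ_[p]))
      (padicHaar p d) (padicHaar p d) :=
  AddMonoidHom.measurePreserving
    (f := (Matrix.vecMulLinear (Q : Matrix (Fin d) (Fin d) ℤ_[p])).toAddMonoidHom)
    (show Continuous fun x : Fin d → ℤ_[p] =>
        Matrix.vecMul x (Q : Matrix (Fin d) (Fin d) ℤ_[p]) from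
      Continuous.matrix_vecMul continuous_id continuous_const)
    (fun y => ⟨Matrix.vecMul y ((Q⁻¹ : GL (Fin d) ℤ_[p]) : Matrix (Fin d) (Fin d) ℤ_[p]), by
      change Matrix.vecMul (Matrix.vecMul y _) (Q : Matrix (Fin d) (Fin d) ℤ_[p]) = y
      rw [Matrix.vecMul_vecMul, ← Units.val_mul, inv_mul_cancel, Units.val_one,
        Matrix.vecMul_one]⟩) rfl

lemma measurableSet_isPrimitive (d : ℕ) :
    MeasurableSet {x : Fin d → ℤ_[p] | IsPrimitive x} :=
  (measurableSet_diagLattice _).compl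

lemma lineVectors_adaptedLattice (t : ℕ × ℕ × ℕ) (Q : GL (Fin 3) ℤ_[p]) :
    lineVectors t (adaptedLattice Q (exponents t)) =
      (fun x => (Q : Matrix (Fin 3) (Fin 3) ℤ_[p]).mulVec x) ⁻¹'
        ((diagLattice p ![t.2.1 + t.2.2, t.2.1, 0] : Set (Fin 3 → ℤ_[p])) \
          (diagLattice p (fun _ : Fin 3 => 1) : Set (Fin 3 → ℤ_[p]))) :=
  Set.ext fun _ => mem_lineVectors_adaptedLattice

lemma dualVectors_adaptedLattice (t : ℕ × ℕ × ℕ) (Q : GL (Fin 3) ℤ_[p]) :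
    dualVectors t (adaptedLattice Q (exponents t)) =
      (fun x => Matrix.vecMul x ((Q⁻¹ : GL (Fin 3) ℤ_[p]) : Matrix (Fin 3) (Fin 3) ℤ_[p])) ⁻¹'
        ((diagLattice p ![0, t.2.2, t.2.2] : Set (Fin 3 → ℤ_[p])) \
          (diagLattice p (fun _ : Fin 3 => 1) : Set (Fin 3 → ℤ_[p]))) :=
  Set.ext fun _ => mem_dualVectors_adaptedLattice

lemma measurableSet_lineVectors {t : ℕ × ℕ × ℕ} {Λ : Submodule ℤ_[p] (Fin 3 → ℤ_[p])}
    (h : HasType Λ t) : MeasurableSet (lineVectors t Λ) := by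
  obtain ⟨Q, rfl⟩ := h
  rw [lineVectors_adaptedLattice]
  exact (measurePreserving_mulVec Q).measurable
    ((measurableSet_diagLattice _).diff (measurableSet_diagLattice _))

lemma measurableSet_dualVectors {t : ℕ × ℕ × ℕ} {Λ : Submodule ℤ_[p] (Fin 3 → ℤ_[p])}
    (h : HasType Λ t) : MeasurableSet (dualVectors t Λ) := by
  obtain ⟨Q, rfl⟩ := h
  rw [dualVectors_adaptedLattice]
  exact (measurePreserving_vecMul Q⁻¹).measurable
    ((measurableSet_diagLattice _).diff (measurableSet_diagLattice _))

/-- The measure of the primitive vectors of `ℤ_p ^ 3` in the diagonal lattice with exponents `n`. -/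
def primitiveVolume (p : ℕ) (n : Fin 3 → ℕ) : ℝ :=
  (p : ℝ)⁻¹ ^ (∑ j, n j) - (p : ℝ)⁻¹ ^ (∑ j, max (n j) 1)

lemma measureReal_lineVectors {t : ℕ × ℕ × ℕ} {Λ : Submodule ℤ_[p] (Fin 3 → ℤ_[p])}
    (h : HasType Λ t) :
    (padicHaar p 3).real (lineVectors t Λ) =
      primitiveVolume p ![t.2.1 + t.2.2, t.2.1, 0] := by
  obtain ⟨Q, rfl⟩ := h
  rw [lineVectors_adaptedLattice, (measurePreserving_mulVec Q).measureReal_preimage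
    ((measurableSet_diagLattice _).diff (measurableSet_diagLattice _)).nullMeasurableSet,
    measureReal_diagLattice_diff, primitiveVolume]

lemma measureReal_dualVectors {t : ℕ × ℕ × ℕ} {Λ : Submodule ℤ_[p] (Fin 3 → ℤ_[p])}
    (h : HasType Λ t) :
    (padicHaar p 3).real (dualVectors t Λ) = primitiveVolume p ![0, t.2.2, t.2.2] := by
  obtain ⟨Q, rfl⟩ := h
  rw [dualVectors_adaptedLattice, (measurePreserving_vecMul Q⁻¹).measureReal_preimage
    ((measurableSet_diagLattice _).diff (measurableSet_diagLattice _)).nullMeasurableSet,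
    measureReal_diagLattice_diff, primitiveVolume]

/-- The primitive vectors killed modulo `p ^ m` by a primitive functional. -/
lemma measureReal_isPrimitive_dvd {ξ : Fin 3 → ℤ_[p]} (hξ : IsPrimitive ξ) (m : ℕ) :
    (padicHaar p 3).real {x | IsPrimitive x ∧ (p : ℤ_[p]) ^ m ∣ dotProduct ξ x} =
      primitiveVolume p ![0, 0, m] := by
  obtain ⟨g, hg⟩ := exists_mulVec_eq_last hξ
  set Q : GL (Fin 3) ℤ_[p] := g⁻¹
  have hξQ : Matrix.mulVec (Q : Matrix (Fin 3) (Fin 3) ℤ_[p]) ![0, 0, 1] = ξ := by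
    rw [← hg, Matrix.mulVec_mulVec, ← Units.val_mul, inv_mul_cancel, Units.val_one,
      Matrix.one_mulVec]
  have : {x | IsPrimitive x ∧ (p : ℤ_[p]) ^ m ∣ dotProduct ξ x} =
      (fun x => Matrix.vecMul x (Q : Matrix (Fin 3) (Fin 3) ℤ_[p])) ⁻¹'
        ((diagLattice p ![0, 0, m] : Set (Fin 3 → ℤ_[p])) \
          (diagLattice p (fun _ : Fin 3 => 1) : Set (Fin 3 → ℤ_[p]))) := by
    ext x
    rw [Set.mem_ofPred_eq, Set.mem_preimage, Set.mem_sdiff, and_comm, SetLike.mem_coe,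
      SetLike.mem_coe, vecMul_mem_diagLattice_const, mem_diagLattice, dotProduct_comm, ← hξQ,
      Matrix.dotProduct_mulVec]
    refine and_congr_left fun _ => ?_
    simp [Fin.forall_fin_succ, dotProduct, Fin.sum_univ_three]
  rw [this, (measurePreserving_vecMul Q).measureReal_preimage
    ((measurableSet_diagLattice _).diff (measurableSet_diagLattice _)).nullMeasurableSet,
    measureReal_diagLattice_diff, primitiveVolume]

/-- Pairs of a primitive functional in `S` and a primitive vector that it kills modulo `p ^ m`. -/
def flagPairs (S : Set (Fin 3 → ℤ_[p])) (m : ℕ) : Set ((Fin 3 → ℤ_[p]) × (Fin 3 → ℤ_[p])) :=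
  {z | (IsPrimitive z.1 ∧ z.1 ∈ S) ∧ IsPrimitive z.2 ∧ (p : ℤ_[p]) ^ m ∣ dotProduct z.1 z.2}

lemma measurableSet_flagPairs {S : Set (Fin 3 → ℤ_[p])} (hS : MeasurableSet S) (m : ℕ) :
    MeasurableSet (flagPairs S m) := by
  refine (((measurableSet_isPrimitive 3).inter hS).preimage measurable_fst).inter
    (((measurableSet_isPrimitive 3).preimage measurable_snd).inter ?_)
  exact ((isClosed_setOf_pow_dvd m).preimage
    (Continuous.dotProduct continuous_fst continuous_snd)).measurableSet

lemma measureReal_flagPairs {S : Set (Fin 3 → ℤ_[p])} (hS : MeasurableSet S) (m : ℕ) :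
    ((padicHaar p 3).prod (padicHaar p 3)).real (flagPairs S m) =
      primitiveVolume p ![0, 0, m] * (padicHaar p 3).real {ξ | IsPrimitive ξ ∧ ξ ∈ S} := by
  have hm : MeasurableSet {ξ : Fin 3 → ℤ_[p] | IsPrimitive ξ ∧ ξ ∈ S} :=
    (measurableSet_isPrimitive 3).inter hS
  have hnn : 0 ≤ primitiveVolume p ![0, 0, m] := by
    rw [primitiveVolume, ← measureReal_diagLattice_diff (p := p) _ (fun _ => 1)]
    exact measureReal_nonneg
  have key : ∀ ξ : Fin 3 → ℤ_[p], padicHaar p 3 (Prod.mk ξ ⁻¹' flagPairs S m) =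
      {ξ : Fin 3 → ℤ_[p] | IsPrimitive ξ ∧ ξ ∈ S}.indicator
        (fun _ => ENNReal.ofReal (primitiveVolume p ![0, 0, m])) ξ := by
    intro ξ
    by_cases h : IsPrimitive ξ ∧ ξ ∈ S
    · rw [Set.indicator_of_mem (by exact h), ← measureReal_isPrimitive_dvd h.1 m,
        ofReal_measureReal]
      congr 1
      ext x
      simp [flagPairs, h]
    · rw [Set.indicator_of_notMem (by exact h)]
      convert measure_empty (μ := padicHaar p 3)
      ext x
      simp only [flagPairs, Set.mem_preimage, Set.mem_ofPred_eq, Set.mem_empty_iff_false, h,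
        false_and]
  rw [measureReal_def, Measure.prod_apply (measurableSet_flagPairs hS m), lintegral_congr key,
    lintegral_indicator_const hm, ENNReal.toReal_mul, ENNReal.toReal_ofReal hnn]
  rfl

lemma measureReal_dualVectors_prod_lineVectors {t : ℕ × ℕ × ℕ}
    {Λ : Submodule ℤ_[p] (Fin 3 → ℤ_[p])} (h : HasType Λ t) :
    ((padicHaar p 3).prod (padicHaar p 3)).real (dualVectors t Λ ×ˢ lineVectors t Λ) =
      primitiveVolume p ![0, t.2.2, t.2.2] * primitiveVolume p ![t.2.1 + t.2.2, t.2.1, 0] := by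
  rw [measureReal_prod_prod, measureReal_dualVectors h, measureReal_lineVectors h]

lemma one_lt_cast_prime : (1 : ℝ) < p := by exact_mod_cast (Fact.out : p.Prime).one_lt

lemma inv_cast_prime_pos : 0 < (p : ℝ)⁻¹ := inv_pos.2 (zero_lt_one.trans one_lt_cast_prime)

lemma inv_cast_prime_lt_one : (p : ℝ)⁻¹ < 1 := inv_lt_one_of_one_lt₀ one_lt_cast_prime

lemma primitiveVolume_pos {n : Fin 3 → ℕ} (hn : ∃ j, n j = 0) : 0 < primitiveVolume p n := by
  rw [primitiveVolume, sub_pos]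
  refine pow_lt_pow_right_of_lt_one₀ inv_cast_prime_pos inv_cast_prime_lt_one ?_
  obtain ⟨j, hj⟩ := hn
  exact Finset.sum_lt_sum (fun i _ => le_max_left _ _) ⟨j, Finset.mem_univ _, by simp [hj]⟩

/-- The sets of pairs of a dual vector and a line vector are disjoint for distinct lattices. -/
lemma pairwiseDisjoint_flags (t : ℕ × ℕ × ℕ) :
    {Λ : Submodule ℤ_[p] (Fin 3 → ℤ_[p]) | HasType Λ t}.PairwiseDisjoint
      fun Λ => dualVectors t Λ ×ˢ lineVectors t Λ := by
  intro Λ hΛ Λ' hΛ' hne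
  refine Set.disjoint_left.2 fun z hz hz' => hne ?_
  exact HasType.eq_of_mem hΛ hΛ' hz.1 hz.2 hz'.1 hz'.2

/-- There are finitely many lattices of each type, as their disjoint sets of flags have the same
positive volume. -/
lemma finite_hasType (t : ℕ × ℕ × ℕ) :
    {Λ : Submodule ℤ_[p] (Fin 3 → ℤ_[p]) | HasType Λ t}.Finite := by
  set μ := (padicHaar p 3).prod (padicHaar p 3)
  set V := primitiveVolume p ![0, t.2.2, t.2.2] * primitiveVolume p ![t.2.1 + t.2.2, t.2.1, 0]
  have hV : 0 < V := mul_pos (primitiveVolume_pos ⟨0, by simp⟩) (primitiveVolume_pos ⟨2, by simp⟩)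
  have h := Measure.finite_const_le_meas_of_disjoint_iUnion μ (ε := ENNReal.ofReal V)
    (As := fun Λ : {Λ : Submodule ℤ_[p] (Fin 3 → ℤ_[p]) | HasType Λ t} =>
      dualVectors t Λ.1 ×ˢ lineVectors t Λ.1) (by simpa using hV)
    (fun Λ => (measurableSet_dualVectors Λ.2).prod (measurableSet_lineVectors Λ.2))
    (fun Λ Λ' hne => pairwiseDisjoint_flags t Λ.2 Λ'.2 fun h => hne (Subtype.ext h))
    (measure_ne_top _ _)
  have huniv : {Λ : {Λ : Submodule ℤ_[p] (Fin 3 → ℤ_[p]) | HasType Λ t} |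
      ENNReal.ofReal V ≤ μ (dualVectors t Λ.1 ×ˢ lineVectors t Λ.1)} = Set.univ := by
    refine Set.eq_univ_of_forall fun Λ => ?_
    rw [Set.mem_ofPred_eq, ← ofReal_measureReal]
    exact ENNReal.ofReal_le_ofReal (measureReal_dualVectors_prod_lineVectors Λ.2).ge
  rw [huniv, Set.finite_univ_iff] at h
  exact h

lemma ncard_mul_volume_eq {t : ℕ × ℕ × ℕ} {A : Set (Submodule ℤ_[p] (Fin 3 → ℤ_[p]))}
    (hA : ∀ Λ ∈ A, HasType Λ t) :
    A.ncard * (primitiveVolume p ![0, t.2.2, t.2.2] *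
      primitiveVolume p ![t.2.1 + t.2.2, t.2.1, 0]) =
    ((padicHaar p 3).prod (padicHaar p 3)).real
      (⋃ Λ ∈ A, dualVectors t Λ ×ˢ lineVectors t Λ) := by
  have hfin : A.Finite := (finite_hasType t).subset hA
  have h := measureReal_biUnion_finset (μ := (padicHaar p 3).prod (padicHaar p 3))
    (s := hfin.toFinset) (f := fun Λ => dualVectors t Λ ×ˢ lineVectors t Λ)
    (by simpa using (pairwiseDisjoint_flags t).subset hA)
    (fun Λ h => (measurableSet_dualVectors (hA Λ (by simpa using h))).prod
      (measurableSet_lineVectors (hA Λ (by simpa using h))))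
  simp only [Set.Finite.mem_toFinset] at h
  rw [h, Finset.sum_congr rfl fun Λ hΛ =>
    measureReal_dualVectors_prod_lineVectors (hA Λ (by simpa using hΛ))]
  rw [Finset.sum_const, nsmul_eq_mul, Set.ncard_eq_toFinset_card _ hfin]

lemma ncard_hasType_mul_le (t : ℕ × ℕ × ℕ) :
    {Λ : Submodule ℤ_[p] (Fin 3 → ℤ_[p]) | HasType Λ t}.ncard *
      (primitiveVolume p ![0, t.2.2, t.2.2] * primitiveVolume p ![t.2.1 + t.2.2, t.2.1, 0]) ≤
    primitiveVolume p ![0, 0, t.2.2] := by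
  rw [ncard_mul_volume_eq (A := {Λ | HasType Λ t}) fun Λ h => h]
  calc _ ≤ ((padicHaar p 3).prod (padicHaar p 3)).real (flagPairs Set.univ t.2.2) := by
        refine measureReal_mono (Set.iUnion₂_subset fun Λ hΛ z hz => ?_)
        exact ⟨⟨hz.1.1, trivial⟩, hz.2.1, dualVectors_dvd_dotProduct hz.1 hz.2⟩
    _ ≤ _ := by
        rw [measureReal_flagPairs MeasurableSet.univ]
        exact mul_le_of_le_one_right (primitiveVolume_pos ⟨0, by simp⟩).le measureReal_le_one

/-- Counting lattices of type `(c, l, m)`, `m > 0`, subject to a condition `S` on their dual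
vectors. -/
lemma ncard_hasType_mul_eq {t : ℕ × ℕ × ℕ} (hm : 0 < t.2.2) {S : Set (Fin 3 → ℤ_[p])}
    (hS : MeasurableSet S) {A : Set (Submodule ℤ_[p] (Fin 3 → ℤ_[p]))}
    (hA : ∀ Λ ∈ A, HasType Λ t)
    (hAS : ∀ Λ, HasType Λ t → ∀ ξ ∈ dualVectors t Λ, ξ ∈ S ↔ Λ ∈ A) :
    A.ncard * (primitiveVolume p ![0, t.2.2, t.2.2] *
      primitiveVolume p ![t.2.1 + t.2.2, t.2.1, 0]) =
    primitiveVolume p ![0, 0, t.2.2] * (padicHaar p 3).real {ξ | IsPrimitive ξ ∧ ξ ∈ S} := by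
  rw [ncard_mul_volume_eq hA, ← measureReal_flagPairs hS]
  congr 1
  ext z
  simp only [Set.mem_iUnion, exists_prop]
  constructor
  · rintro ⟨Λ, hΛ, hz⟩
    exact ⟨⟨hz.1.1, (hAS Λ (hA Λ hΛ) _ hz.1).2 hΛ⟩, hz.2.1, dualVectors_dvd_dotProduct hz.1 hz.2⟩
  · rintro ⟨⟨h1, h2⟩, h3, h4⟩
    obtain ⟨Λ, hΛ, hξ, hx⟩ := exists_hasType_of_dvd_dotProduct hm h1 h3 h4
    exact ⟨Λ, (hAS Λ hΛ _ hξ).1 h2, hξ, hx⟩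

end Measure

/-! ### Attached forms under a change of basis -/

section BasisChange

variable {R : Type*} [CommRing R] {L : Type*} [LieRing L] [LieAlgebra R L]

lemma basisForm_apply (b : Module.Basis (Fin 3) R L) (x : Fin 3 → R) :
    basisForm b x = dotProduct x ((structureMatrix b).mulVec x) := by
  rw [basisForm, LinearMap.BilinMap.toQuadraticMap_apply, Matrix.toBilin'_apply']

lemma repr_lie (b : Module.Basis (Fin 3) R L) (u v : L) (j : Fin 3) :
    b.repr ⁅u, v⁆ j =
      (b.repr u 1 * b.repr v 2 - b.repr u 2 * b.repr v 1) * structureMatrix b 0 j +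
      (b.repr u 2 * b.repr v 0 - b.repr u 0 * b.repr v 2) * structureMatrix b 1 j +
      (b.repr u 0 * b.repr v 1 - b.repr u 1 * b.repr v 0) * structureMatrix b 2 j := by
  conv_lhs => rw [← b.sum_repr u, ← b.sum_repr v]
  simp only [Fin.sum_univ_three, add_lie, lie_add, smul_lie, lie_smul, lie_self, map_add,
    map_smul, smul_zero, map_zero, Finsupp.add_apply, Finsupp.smul_apply, smul_eq_mul]
  rw [← lie_skew (b 1) (b 0), ← lie_skew (b 2) (b 1), ← lie_skew (b 0) (b 2)]
  simp only [map_neg, Finsupp.neg_apply, structureMatrix, Matrix.of_apply, Matrix.cons_val]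
  simp only [Finsupp.zero_apply]
  ring

/-- Up to the determinant of the change of basis, the attached form is a form on the dual of `L`:
the row vector `ξ P` holds the values on `b'` of the functional with values `ξ` on `b`. -/
lemma basisForm_vecMul {b b' : Module.Basis (Fin 3) R L} {P : Matrix (Fin 3) (Fin 3) R}
    (h : ∀ v, (b.repr v : Fin 3 → R) = P.mulVec (b'.repr v)) (ξ : Fin 3 → R) :
    basisForm b' (Matrix.vecMul ξ P) = P.det * basisForm b ξ := by
  have hP : ∀ i j, b.repr (b' j) i = P i j := by
    intro i j
    rw [h, b'.repr_self, Finsupp.single_eq_pi_single, Matrix.mulVec_single_one, Matrix.col_apply]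
  -- Evaluate `ξ` on the bracket of two vectors of `b'` in both coordinate systems.
  have key : ∀ j k, dotProduct (Matrix.vecMul ξ P) (b'.repr ⁅b' j, b' k⁆) =
      dotProduct ξ (b.repr ⁅b' j, b' k⁆) := by
    intro j k
    rw [← Matrix.dotProduct_mulVec, h]
  have k0 := key 1 2
  have k1 := key 2 0
  have k2 := key 0 1
  have expand : basisForm b' (Matrix.vecMul ξ P) =
      Matrix.vecMul ξ P 0 * dotProduct (Matrix.vecMul ξ P) (b'.repr ⁅b' 1, b' 2⁆) +
      Matrix.vecMul ξ P 1 * dotProduct (Matrix.vecMul ξ P) (b'.repr ⁅b' 2, b' 0⁆) +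
      Matrix.vecMul ξ P 2 * dotProduct (Matrix.vecMul ξ P) (b'.repr ⁅b' 0, b' 1⁆) := by
    rw [basisForm_apply]
    simp only [Matrix.mulVec, dotProduct, Fin.sum_univ_three, structureMatrix, Matrix.of_apply,
      Matrix.cons_val]
    ring
  rw [expand, k0, k1, k2, basisForm_apply, Matrix.det_fin_three]
  simp only [dotProduct, Fin.sum_univ_three, Matrix.mulVec, Matrix.vecMul, repr_lie b, hP]
  ring

/-- The basis with coordinates `Q x`, where `x` are the coordinates with respect to `b`. -/
def transformBasis {M : Type*} [AddCommGroup M] [Module R M] {d : ℕ}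
    (b : Module.Basis (Fin d) R M) (Q : GL (Fin d) R) : Module.Basis (Fin d) R M :=
  Module.Basis.ofEquivFun (b.equivFun ≪≫ₗ
    Matrix.toLin'OfInv (M := (Q⁻¹ : GL (Fin d) R)) (M' := (Q : GL (Fin d) R)) Q.inv_mul Q.mul_inv)

lemma repr_transformBasis {M : Type*} [AddCommGroup M] [Module R M] {d : ℕ}
    (b : Module.Basis (Fin d) R M) (Q : GL (Fin d) R) (v : M) :
    ((transformBasis b Q).repr v : Fin d → R) =
      (Q : Matrix (Fin d) (Fin d) R).mulVec (b.repr v) := by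
  change (transformBasis b Q).equivFun v = _
  rw [transformBasis, Module.Basis.equivFun_ofEquivFun]
  rfl

lemma repr_eq_mulVec_repr_transformBasis {M : Type*} [AddCommGroup M] [Module R M] {d : ℕ}
    (b : Module.Basis (Fin d) R M) (Q : GL (Fin d) R) (v : M) :
    (b.repr v : Fin d → R) =
      ((Q⁻¹ : GL (Fin d) R) : Matrix (Fin d) (Fin d) R).mulVec ((transformBasis b Q).repr v) := by
  rw [repr_transformBasis, Matrix.mulVec_mulVec, ← Units.val_mul, inv_mul_cancel,
    Units.val_one, Matrix.one_mulVec]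

lemma vecMul_vecMul_inv {d : ℕ} (Q : GL (Fin d) R) (x : Fin d → R) :
    Matrix.vecMul (Matrix.vecMul x ((Q⁻¹ : GL (Fin d) R) : Matrix (Fin d) (Fin d) R))
      (Q : Matrix (Fin d) (Fin d) R) = x := by
  rw [Matrix.vecMul_vecMul, ← Units.val_mul, inv_mul_cancel, Units.val_one, Matrix.vecMul_one]

lemma vecMul_inv_vecMul {d : ℕ} (Q : GL (Fin d) R) (x : Fin d → R) :
    Matrix.vecMul (Matrix.vecMul x (Q : Matrix (Fin d) (Fin d) R))
      ((Q⁻¹ : GL (Fin d) R) : Matrix (Fin d) (Fin d) R) = x := by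
  rw [Matrix.vecMul_vecMul, ← Units.val_mul, mul_inv_cancel, Units.val_one, Matrix.vecMul_one]

/-- Every automorphism of `R ^ d` acts on row vectors through an invertible matrix. -/
lemma exists_vecMul_eq {d : ℕ} (e : (Fin d → R) ≃ₗ[R] (Fin d → R)) :
    ∃ E : GL (Fin d) R, ∀ x, e x = Matrix.vecMul x (E : Matrix (Fin d) (Fin d) R) := by
  refine ⟨⟨(LinearMap.toMatrix' e.toLinearMap).transpose,
    (LinearMap.toMatrix' e.symm.toLinearMap).transpose, ?_, ?_⟩, fun x => ?_⟩
  · rw [← Matrix.transpose_mul, ← LinearMap.toMatrix'_comp]; simp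
  · rw [← Matrix.transpose_mul, ← LinearMap.toMatrix'_comp]; simp
  · rw [Matrix.vecMul_transpose, LinearMap.toMatrix'_mulVec]; rfl

/-- Row vectors times an invertible matrix, as a linear automorphism. -/
def vecMulEquiv {d : ℕ} (Q : GL (Fin d) R) : (Fin d → R) ≃ₗ[R] (Fin d → R) :=
  LinearEquiv.ofLinearMap (Matrix.vecMulLinear (Q : Matrix (Fin d) (Fin d) R))
    (Matrix.vecMulLinear ((Q⁻¹ : GL (Fin d) R) : Matrix (Fin d) (Fin d) R))
    (LinearMap.ext fun x => vecMul_vecMul_inv Q x)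
    (LinearMap.ext fun x => vecMul_inv_vecMul Q x)

lemma exists_repr_eq_mulVec {M : Type*} [AddCommGroup M] [Module R M] {d : ℕ}
    (b b' : Module.Basis (Fin d) R M) :
    ∃ P : GL (Fin d) R, ∀ v,
      (b.repr v : Fin d → R) = (P : Matrix (Fin d) (Fin d) R).mulVec (b'.repr v) := by
  refine ⟨⟨b.toMatrix b', b'.toMatrix b, b.toMatrix_mul_toMatrix_flip b',
    b'.toMatrix_mul_toMatrix_flip b⟩, fun v => ?_⟩
  exact (b'.toMatrix_mulVec_repr b v).symm

/-- Rescaling the basis by `r` multiplies the attached form by `r`, so every unit occurs as a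
similarity factor. -/
lemma isAttachedForm_iff_formEquiv {f g : QuadraticForm R (Fin 3 → R)}
    (hf : IsAttachedForm L f) : IsAttachedForm L g ↔ FormEquiv f g := by
  obtain ⟨b, rfl⟩ := hf
  constructor
  · rintro ⟨b', rfl⟩
    obtain ⟨P, hP⟩ := exists_repr_eq_mulVec b b'
    refine ⟨Matrix.GeneralLinearGroup.det P, vecMulEquiv P⁻¹, fun x => ?_⟩
    have := basisForm_vecMul hP (Matrix.vecMul x ((P⁻¹ : GL (Fin 3) R) : Matrix _ _ R))
    rw [vecMul_vecMul_inv] at this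
    exact this
  · rintro ⟨u, e, h⟩
    obtain ⟨E, hE⟩ := exists_vecMul_eq e
    -- The new coordinates are `r E` applied to the old ones, with `r` chosen to match `u`.
    set r : Rˣ := (u * Matrix.GeneralLinearGroup.det E)⁻¹ with hr
    set Q : GL (Fin 3) R := Matrix.GeneralLinearGroup.scalar (Fin 3) r * E with hQ
    refine ⟨transformBasis b Q, QuadraticMap.ext fun x => ?_⟩
    have key := basisForm_vecMul (repr_eq_mulVec_repr_transformBasis b Q)
      (Matrix.vecMul x (Q : Matrix (Fin 3) (Fin 3) R))
    rw [vecMul_inv_vecMul] at key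
    have hx : Matrix.vecMul x (Q : Matrix (Fin 3) (Fin 3) R) = (r : R) • e x := by
      rw [hQ, hE, Units.val_mul, ← Matrix.vecMul_vecMul]
      simp [Matrix.GeneralLinearGroup.scalar, Matrix.smul_vecMul]
    have hdet : Matrix.GeneralLinearGroup.det Q⁻¹ * r ^ 2 = u := by
      have : Matrix.GeneralLinearGroup.det Q = r ^ 3 * Matrix.GeneralLinearGroup.det E := by
        rw [hQ, map_mul]
        congr 1
        ext
        simp [Matrix.GeneralLinearGroup.scalar]
      rw [map_inv, this, hr]
      group
      rw [zpow_neg_one, mul_right_comm, inv_mul_cancel, one_mul]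
    have hdet' : ((Q⁻¹ : GL (Fin 3) R) : Matrix (Fin 3) (Fin 3) R).det * (r : R) ^ 2 = u := by
      have := congrArg (Units.val) hdet
      simpa using this
    rw [key, hx, QuadraticMap.map_smul, h, ← hdet', smul_eq_mul]
    ring

end BasisChange

/-! ### Lattices closed under the bracket -/

section Closure

variable {p : ℕ} [Fact p.Prime] {N : Type*} [LieRing N] [LieAlgebra ℤ_[p] N]

/-- The vectors with coordinates in `Λ` are closed under the bracket. -/
def IsBracketClosed (b : Module.Basis (Fin 3) ℤ_[p] N)
    (Λ : Submodule ℤ_[p] (Fin 3 → ℤ_[p])) : Prop :=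
  ∀ u v, (b.repr u : Fin 3 → ℤ_[p]) ∈ Λ → (b.repr v : Fin 3 → ℤ_[p]) ∈ Λ →
    (b.repr ⁅u, v⁆ : Fin 3 → ℤ_[p]) ∈ Λ

/-- The diagonal lattice with exponents `(c + l + m, c + l, c)` is a subalgebra exactly when the first
coordinate of the bracket of the last two generators `p ^ (c + l) e₂` and `p ^ c e₃` is divisible
by `p ^ (c + l + m)`. -/
lemma isBracketClosed_diagLattice (b : Module.Basis (Fin 3) ℤ_[p] N) (t : ℕ × ℕ × ℕ) :
    IsBracketClosed b (diagLattice p (exponents t)) ↔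
      (p : ℤ_[p]) ^ t.2.2 ∣ (p : ℤ_[p]) ^ t.1 * structureMatrix b 0 0 := by
  obtain ⟨c, l, m⟩ := t
  simp only
  have hiff : (p : ℤ_[p]) ^ m ∣ (p : ℤ_[p]) ^ c * structureMatrix b 0 0 ↔
      (p : ℤ_[p]) ^ (c + l + m) ∣
        (p : ℤ_[p]) ^ (c + l) * ((p : ℤ_[p]) ^ c * structureMatrix b 0 0) := by
    rw [pow_add _ (c + l), mul_dvd_mul_iff_left (p_pow_ne_zero _)]
  rw [hiff]
  constructor
  · intro h
    have := h ((p : ℤ_[p]) ^ (c + l) • b 1) ((p : ℤ_[p]) ^ c • b 2) ?_ ?_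
    · have := mem_diagLattice.1 this 0
      rw [repr_lie] at this
      simpa [exponents, Finsupp.single_apply, mul_assoc] using this
    · rw [mem_diagLattice]
      intro j
      fin_cases j <;> simp [exponents]
    · rw [mem_diagLattice]
      intro j
      fin_cases j <;> simp [exponents]
  · intro h u v hu hv
    rw [mem_diagLattice] at hu hv ⊢
    have u0 := hu 0
    have u1 := hu 1
    have u2 := hu 2
    have v0 := hv 0
    have v1 := hv 1
    have v2 := hv 2
    simp only [exponents, Matrix.cons_val] at u0 u1 u2 v0 v1 v2
    have h0 : (p : ℤ_[p]) ^ (c + l + c) ∣ b.repr u 1 * b.repr v 2 - b.repr u 2 * b.repr v 1 := by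
      rw [pow_add _ (c + l)]
      refine dvd_sub (mul_dvd_mul u1 v2) ?_
      rw [mul_comm (b.repr u 2)]
      exact mul_dvd_mul v1 u2
    have h1 : (p : ℤ_[p]) ^ (c + l + m) ∣ b.repr u 2 * b.repr v 0 - b.repr u 0 * b.repr v 2 :=
      dvd_sub (v0.mul_left _) (u0.mul_right _)
    have h2 : (p : ℤ_[p]) ^ (c + l + m) ∣ b.repr u 0 * b.repr v 1 - b.repr u 1 * b.repr v 0 :=
      dvd_sub (u0.mul_right _) (v0.mul_left _)
    intro j
    rw [repr_lie]
    by_cases hj : j = 0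
    · subst hj
      refine dvd_add (dvd_add ?_ (h1.mul_right _)) (h2.mul_right _)
      refine h.trans ?_
      rw [← mul_assoc, ← pow_add]
      exact mul_dvd_mul_right h0 _
    · have hle : exponents (c, l, m) j ≤ c + l := by
        fin_cases j
        · exact absurd rfl hj
        · simp [exponents]
        · simp [exponents]
      have hd := pow_dvd_pow (p : ℤ_[p]) hle
      have hd0 := hd.trans (pow_dvd_pow (p : ℤ_[p]) (Nat.le_add_right (c + l) c))
      have hdm := hd.trans (pow_dvd_pow (p : ℤ_[p]) (Nat.le_add_right (c + l) m))
      exact dvd_add (dvd_add ((hd0.trans h0).mul_right _) ((hdm.trans h1).mul_right _))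
        ((hdm.trans h2).mul_right _)

/-- A lattice is a subalgebra if and only if the attached form is sufficiently divisible at its
dual vectors. -/
lemma HasType.isBracketClosed_iff {b : Module.Basis (Fin 3) ℤ_[p] N} {t : ℕ × ℕ × ℕ}
    {Λ : Submodule ℤ_[p] (Fin 3 → ℤ_[p])} (hΛ : HasType Λ t) {ξ : Fin 3 → ℤ_[p]}
    (hξ : ξ ∈ dualVectors t Λ) :
    IsBracketClosed b Λ ↔ (p : ℤ_[p]) ^ t.2.2 ∣ (p : ℤ_[p]) ^ t.1 * basisForm b ξ := by
  obtain ⟨Q, rfl⟩ := hΛ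
  have hclosed : IsBracketClosed b (adaptedLattice Q (exponents t)) ↔
      IsBracketClosed (transformBasis b Q) (diagLattice p (exponents t)) := by
    simp only [IsBracketClosed, repr_transformBasis, mem_adaptedLattice, mem_diagLattice]
  rw [hclosed, isBracketClosed_diagLattice]
  rw [mem_dualVectors_adaptedLattice] at hξ
  have hform := basisForm_vecMul (repr_eq_mulVec_repr_transformBasis b Q) ξ
  set A := structureMatrix (transformBasis b Q)
  set η := Matrix.vecMul ξ ((Q⁻¹ : GL (Fin 3) ℤ_[p]) : Matrix (Fin 3) (Fin 3) ℤ_[p])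
  obtain ⟨hη, hη1⟩ := hξ
  change IsPrimitive η at hη1
  obtain ⟨j, hj⟩ := isPrimitive_iff_exists.1 hη1
  simp [mem_diagLattice, Fin.forall_fin_succ] at hη
  rcases Nat.eq_zero_or_pos t.2.2 with hm | hm
  · simp [hm]
  have hp : ¬ IsUnit ((p : ℤ_[p]) ^ t.2.2) := by
    rw [isUnit_pow_iff hm.ne']; exact PadicInt.prime_p.not_isUnit
  have hunit : IsUnit (η 0) := by
    fin_cases j
    · exact hj
    · exact absurd (isUnit_of_dvd_unit hη.1 hj) hp
    · exact absurd (isUnit_of_dvd_unit hη.2 hj) hp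
  have hdet : IsUnit ((Q⁻¹ : GL (Fin 3) ℤ_[p]) : Matrix (Fin 3) (Fin 3) ℤ_[p]).det :=
    (Matrix.isUnit_iff_isUnit_det _).1 (Q⁻¹).isUnit
  -- Modulo `p ^ m` only the term `η₀² A₀₀` of the form survives.
  obtain ⟨⟨x1, h1⟩, ⟨x2, h2⟩⟩ := hη
  have hexp : (p : ℤ_[p]) ^ t.2.2 ∣ (p : ℤ_[p]) ^ t.1 * basisForm (transformBasis b Q) η -
      η 0 ^ 2 * ((p : ℤ_[p]) ^ t.1 * A 0 0) := by
    rw [basisForm_apply]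
    refine ⟨(p : ℤ_[p]) ^ t.1 * (η 0 * (A 0 1 * x1 + A 0 2 * x2) +
      x1 * (A 1 0 * η 0 + A 1 1 * η 1 + A 1 2 * η 2) +
      x2 * (A 2 0 * η 0 + A 2 1 * η 1 + A 2 2 * η 2)), ?_⟩
    simp only [dotProduct, Matrix.mulVec, Fin.sum_univ_three, h1, h2]
    ring
  calc _ ↔ (p : ℤ_[p]) ^ t.2.2 ∣ η 0 ^ 2 * ((p : ℤ_[p]) ^ t.1 * A 0 0) :=
        ((hunit.pow 2).dvd_mul_left).symm
    _ ↔ (p : ℤ_[p]) ^ t.2.2 ∣ (p : ℤ_[p]) ^ t.1 * basisForm (transformBasis b Q) η :=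
        (dvd_iff_dvd_of_dvd_sub hexp).symm
    _ ↔ _ := by rw [hform, mul_left_comm, hdet.dvd_mul_left]

end Closure

/-! ### The Lie algebra `a L` -/

section Scaled

variable {R : Type*} [CommRing R] [IsDomain R] {L : Type*} [LieRing L] [LieAlgebra R L]

/-- Multiplication by `a` as a map onto `a L`. -/
def toScaled (a : R) (L : Type*) [LieRing L] [LieAlgebra R L] : L →ₗ[R] scaled a L where
  toFun x := ⟨a • x, x, rfl⟩
  map_add' x y := Subtype.ext (smul_add a x y)
  map_smul' r x := Subtype.ext (smul_comm a r x)

/-- The basis `a e₁, a e₂, a e₃` of `a L`. -/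
def scaledBasis (b : Module.Basis (Fin 3) R L) {a : R} (ha : a ≠ 0) :
    Module.Basis (Fin 3) R (scaled a L) :=
  b.map (LinearEquiv.ofBijective (toScaled a L) ⟨fun x y h => by
    have := Module.Free.of_basis b
    exact LinearMap.lsmul_injective ha (congrArg Subtype.val h),
    fun ⟨_, x, hx⟩ => ⟨x, Subtype.ext hx⟩⟩)

lemma repr_scaledBasis (b : Module.Basis (Fin 3) R L) {a : R} (ha : a ≠ 0) (x : L)
    (v : scaled a L) (h : (v : L) = a • x) : (scaledBasis b ha).repr v = b.repr x := by
  refine congrArg b.repr ?_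
  exact (LinearEquiv.symm_apply_eq _).2 (Subtype.ext h)

lemma basisForm_scaledBasis (b : Module.Basis (Fin 3) R L) {a : R} (ha : a ≠ 0)
    (x : Fin 3 → R) : basisForm (scaledBasis b ha) x = a * basisForm b x := by
  have hb : ∀ j, ((scaledBasis b ha j : scaled a L) : L) = a • b j := fun j => rfl
  have h : ∀ j k, (scaledBasis b ha).repr ⁅scaledBasis b ha j, scaledBasis b ha k⁆ =
      a • b.repr ⁅b j, b k⁆ := by
    intro j k
    rw [repr_scaledBasis b ha (a • ⁅b j, b k⁆), map_smul]
    rw [LieSubalgebra.coe_bracket, hb, hb, smul_lie, lie_smul]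
  have hA : structureMatrix (scaledBasis b ha) = a • structureMatrix b := by
    ext j k
    fin_cases j <;> simp [structureMatrix, h]
  rw [basisForm_apply, basisForm_apply, hA, Matrix.smul_mulVec, dotProduct_smul, smul_eq_mul]

end Scaled

/-! ### Igusa's integral over primitive vectors -/

section IgusaIntegral

variable {p : ℕ} [Fact p.Prime]

lemma isOpenEmbedding_prime_smul (d : ℕ) :
    Topology.IsOpenEmbedding fun x : Fin d → ℤ_[p] => (p : ℤ_[p]) • x := by
  have hcont : Continuous fun x : Fin d → ℤ_[p] => (p : ℤ_[p]) • x := continuous_const_smul _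
  have hp : (p : ℤ_[p]) ≠ 0 := by simpa using p_pow_ne_zero (p := p) 1
  have hclosed := hcont.isClosedEmbedding fun x y h => smul_right_injective _ hp h
  refine ⟨hclosed.isEmbedding, ?_⟩
  -- The image is a closed subgroup of finite index.
  have hrange : Set.range (fun x : Fin d → ℤ_[p] => (p : ℤ_[p]) • x) =
      ((diagLattice p fun _ : Fin d => 1).toAddSubgroup : Set (Fin d → ℤ_[p])) := by
    ext x
    rw [Submodule.coe_toAddSubgroup, SetLike.mem_coe, mem_diagLattice_const]
    simp [eq_comm]
  have hc := hclosed.isClosed_range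
  rw [hrange] at hc ⊢
  have : (diagLattice p fun _ : Fin d => 1).toAddSubgroup.FiniteIndex := by
    refine ⟨?_⟩
    have : (diagLattice p fun _ : Fin d => 1).toAddSubgroup.index = _ :=
      card_quotient_diagLattice _
    rw [this]
    exact pow_ne_zero _ (Fact.out : p.Prime).ne_zero
  exact AddSubgroup.isOpen_of_isClosed_of_finiteIndex _ hc

lemma range_prime_smul (d : ℕ) :
    Set.range (fun x : Fin d → ℤ_[p] => (p : ℤ_[p]) • x) = {x | IsPrimitive x}ᶜ := by
  ext x
  simp only [IsPrimitive, Set.mem_compl_iff, Set.mem_ofPred_eq, not_not, mem_diagLattice_const]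
  simp [eq_comm]

/-- The change of variables `x ↦ p x`. -/
lemma setIntegral_compl_isPrimitive {d : ℕ} (F : (Fin d → ℤ_[p]) → ℂ) :
    ∫ x in {x | IsPrimitive x}ᶜ, F x ∂(padicHaar p d) =
      (p : ℂ)⁻¹ ^ d * ∫ x, F ((p : ℤ_[p]) • x) ∂(padicHaar p d) := by
  set φ : (Fin d → ℤ_[p]) →+ (Fin d → ℤ_[p]) :=
    DistribSMul.toAddMonoidHom (Fin d → ℤ_[p]) (p : ℤ_[p]) with hφ
  have hopen : Topology.IsOpenEmbedding φ := isOpenEmbedding_prime_smul d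
  have hrange : Set.range φ = {x | IsPrimitive x}ᶜ := range_prime_smul d
  set ν := (padicHaar p d).comap φ with hν
  have : ν.IsAddHaarMeasure := Measure.IsAddHaarMeasure.comap (mH := inferInstance) _ hopen
  have hsmul := Measure.isAddInvariant_eq_smul_of_compactSpace ν (padicHaar p d)
  set c := Measure.addHaarScalarFactor ν (padicHaar p d)
  have hc : (c : ℝ) = (p : ℝ)⁻¹ ^ d := by
    have h1 : ν.real Set.univ = (p : ℝ)⁻¹ ^ d := by
      rw [measureReal_def, hν, hopen.measurableEmbedding.comap_apply, Set.image_univ, hrange]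
      have h2 : ({x | IsPrimitive x}ᶜ : Set (Fin d → ℤ_[p])) =
          diagLattice p fun _ : Fin d => 1 := by
        ext x; simp [IsPrimitive]
      rw [h2, ← measureReal_def]
      simpa using measureReal_diagLattice (p := p) fun _ : Fin d => 1
    rw [hsmul] at h1
    simpa using h1
  rw [← hrange, ← hopen.measurableEmbedding.map_comap,
    hopen.measurableEmbedding.integral_map, ← hν, hsmul, integral_smul_nnreal_measure]
  rw [NNReal.smul_def, hc, Complex.real_smul]
  push_cast
  rfl

lemma continuous_basisForm {N : Type*} [LieRing N] [LieAlgebra ℤ_[p] N]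
    (b : Module.Basis (Fin 3) ℤ_[p] N) : Continuous (basisForm b) := by
  have : ⇑(basisForm b) = fun x => dotProduct x ((structureMatrix b).mulVec x) :=
    funext (basisForm_apply b)
  rw [this]
  exact Continuous.dotProduct continuous_id (Continuous.matrix_mulVec continuous_const continuous_id)

lemma continuous_norm_cpow {d : ℕ} {g : (Fin d → ℤ_[p]) → ℤ_[p]} (hg : Continuous g) {s : ℂ}
    (hs : 0 < s.re) : Continuous fun x => ((‖g x‖ : ℝ) : ℂ) ^ s :=
  (Complex.continuous_ofReal_cpow_const hs).comp hg.norm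

lemma integrable_norm_cpow {d : ℕ} {g : (Fin d → ℤ_[p]) → ℤ_[p]} (hg : Continuous g) {s : ℂ}
    (hs : 0 < s.re) : Integrable (fun x => ((‖g x‖ : ℝ) : ℂ) ^ s) (padicHaar p d) := by
  refine Integrable.of_bound (continuous_norm_cpow hg hs).aestronglyMeasurable 1
    (Filter.Eventually.of_forall fun x => ?_)
  rw [Complex.norm_cpow_eq_rpow_re_of_nonneg (norm_nonneg _) hs.ne']
  exact Real.rpow_le_one (norm_nonneg _) (PadicInt.norm_le_one _) hs.le

lemma cast_prime_ne_zero : (p : ℂ) ≠ 0 := by exact_mod_cast (Fact.out : p.Prime).ne_zero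

lemma norm_prime_pow_cpow (k : ℕ) (s : ℂ) :
    ((‖(p : ℤ_[p]) ^ k‖ : ℝ) : ℂ) ^ s = ((p : ℂ) ^ (-s)) ^ k := by
  have h : ((‖(p : ℤ_[p]) ^ k‖ : ℝ) : ℂ) = (((p : ℂ) ^ k))⁻¹ := by
    rw [PadicInt.norm_p_pow]; push_cast; rw [zpow_neg, zpow_natCast]
  rw [h, ← Complex.cpow_nat_mul, mul_neg, Complex.cpow_neg, Complex.natCast_cpow_natCast_mul,
    Complex.inv_cpow]
  rw [← Nat.cast_pow, Complex.natCast_arg]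
  exact Real.pi_pos.ne

lemma norm_mul_cpow (a b : ℤ_[p]) (s : ℂ) :
    ((‖a * b‖ : ℝ) : ℂ) ^ s = ((‖a‖ : ℝ) : ℂ) ^ s * ((‖b‖ : ℝ) : ℂ) ^ s := by
  rw [norm_mul, Complex.ofReal_mul, Complex.mul_cpow_ofReal_nonneg (norm_nonneg _) (norm_nonneg _)]

/-- Splitting off the primitive vectors, Igusa's zeta function of a form of degree `2` is determined
by its values there. -/
lemma setIntegral_isPrimitive_eq_igusaZeta_mul {d : ℕ}
    (f : QuadraticForm ℤ_[p] (Fin d → ℤ_[p])) (hf : Continuous f) {s : ℂ} (hs : 0 < s.re) :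
    ∫ x in {x | IsPrimitive x}, ((‖f x‖ : ℝ) : ℂ) ^ s ∂(padicHaar p d) =
      igusaZeta p f s * (1 - (p : ℂ)⁻¹ ^ d * ((p : ℂ) ^ (-s)) ^ 2) := by
  have h := integral_add_compl (measurableSet_isPrimitive (p := p) d) (integrable_norm_cpow hf hs)
  rw [setIntegral_compl_isPrimitive] at h
  have h2 : ∀ x : Fin d → ℤ_[p], ((‖f ((p : ℤ_[p]) • x)‖ : ℝ) : ℂ) ^ s =
      ((p : ℂ) ^ (-s)) ^ 2 * ((‖f x‖ : ℝ) : ℂ) ^ s := by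
    intro x
    rw [QuadraticMap.map_smul, smul_eq_mul, norm_mul_cpow, ← pow_two, norm_prime_pow_cpow]
  simp_rw [h2] at h
  rw [integral_const_mul] at h
  rw [igusaZeta]
  linear_combination h

open scoped Classical in
/-- Both sides vanish for `a = 0`, where `p ^ m ∣ a` for all `m` and `0 ^ s = 0`. -/
lemma hasSum_pow_of_not_dvd {s : ℂ} (hs : 0 < s.re) (a : ℤ_[p]) :
    HasSum (fun m : ℕ => if (p : ℤ_[p]) ^ m ∣ a then 0 else ((p : ℂ) ^ (-s)) ^ m)
      ((p : ℂ) ^ (-s) / (1 - (p : ℂ) ^ (-s)) * ((‖a‖ : ℝ) : ℂ) ^ s) := by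
  set y := (p : ℂ) ^ (-s) with hy
  have hy1 : ‖y‖ < 1 := by
    rw [hy, Complex.norm_natCast_cpow_of_pos (Fact.out : p.Prime).pos]
    exact Real.rpow_lt_one_of_one_lt_of_neg one_lt_cast_prime (by simpa using hs)
  by_cases ha : a = 0
  · subst ha
    have hs0 : s ≠ 0 := by rintro rfl; simp at hs
    simp [Complex.zero_cpow hs0, hasSum_zero]
  · have hdvd : ∀ m : ℕ, (p : ℤ_[p]) ^ m ∣ a ↔ m ≤ a.valuation := by
      intro m
      rw [← Ideal.mem_span_singleton, PadicInt.mem_span_pow_iff_le_valuation a ha]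
    have hnorm : ((‖a‖ : ℝ) : ℂ) ^ s = y ^ a.valuation := by
      rw [hy, ← norm_prime_pow_cpow, PadicInt.norm_p_pow, PadicInt.norm_eq_zpow_neg_valuation ha]
    rw [hnorm]
    simp_rw [hdvd]
    have hgeo := (hasSum_geometric_of_norm_lt_one hy1).mul_left (y ^ (a.valuation + 1))
    rw [← hasSum_nat_add_iff' (a.valuation + 1)]
    convert! hgeo using 1
    · funext m
      rw [if_neg (by omega)]
      ring
    · rw [Finset.sum_eq_zero fun m hm => if_pos (by
        have := Finset.mem_range.1 hm; omega)]
      ring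

open scoped Classical in
/-- The generating series of the measures of the sets where `p ^ m` does not divide `g` is an
integral of a power of the absolute value of `g`. -/
lemma hasSum_measureReal_not_dvd {d : ℕ} {g : (Fin d → ℤ_[p]) → ℤ_[p]} (hg : Continuous g) {s : ℂ}
    (hs : 0 < s.re) :
    HasSum (fun m : ℕ => ((p : ℂ) ^ (-s)) ^ m *
        ((padicHaar p d).real {x | IsPrimitive x ∧ x ∈ {x | ¬ (p : ℤ_[p]) ^ m ∣ g x}} : ℂ))
      ((p : ℂ) ^ (-s) / (1 - (p : ℂ) ^ (-s)) *
        ∫ x in {x | IsPrimitive x}, ((‖g x‖ : ℝ) : ℂ) ^ s ∂(padicHaar p d)) := by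
  set y := (p : ℂ) ^ (-s) with hy
  have hy1 : ‖y‖ < 1 := by
    rw [hy, Complex.norm_natCast_cpow_of_pos (Fact.out : p.Prime).pos]
    exact Real.rpow_lt_one_of_one_lt_of_neg one_lt_cast_prime (by simpa using hs)
  set μ := (padicHaar p d).restrict {x | IsPrimitive x}
  have hmeas : ∀ m : ℕ, MeasurableSet {x | ¬ (p : ℤ_[p]) ^ m ∣ g x} := fun m =>
    ((isClosed_setOf_pow_dvd m).preimage hg).measurableSet.compl
  have hF : ∀ m : ℕ, (fun x => if (p : ℤ_[p]) ^ m ∣ g x then 0 else y ^ m) =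
      {x | ¬ (p : ℤ_[p]) ^ m ∣ g x}.indicator fun _ => y ^ m := by
    intro m
    funext x
    by_cases h : (p : ℤ_[p]) ^ m ∣ g x <;> simp [h]
  have hint : ∀ m : ℕ, Integrable (fun x => if (p : ℤ_[p]) ^ m ∣ g x then 0 else y ^ m) μ := by
    intro m
    rw [hF]
    exact (integrable_const _).indicator (hmeas m)
  have hval : ∀ m : ℕ, ∫ x, (if (p : ℤ_[p]) ^ m ∣ g x then 0 else y ^ m) ∂μ = y ^ m *
      ((padicHaar p d).real {x | IsPrimitive x ∧ x ∈ {x | ¬ (p : ℤ_[p]) ^ m ∣ g x}} : ℂ) := by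
    intro m
    rw [hF, integral_indicator_const _ (hmeas m), Complex.real_smul, mul_comm,
      measureReal_restrict_apply (hmeas m), Set.inter_comm]
    rfl
  have hsum : Summable fun m : ℕ =>
      ∫ x, ‖if (p : ℤ_[p]) ^ m ∣ g x then 0 else y ^ m‖ ∂μ := by
    refine Summable.of_nonneg_of_le (fun m => integral_nonneg fun x => norm_nonneg _)
      (fun m => ?_) (summable_geometric_of_lt_one (norm_nonneg y) hy1)
    calc _ ≤ ∫ x, ‖y‖ ^ m ∂μ := by
          refine integral_mono (hint m).norm (integrable_const _) fun x => ?_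
          dsimp only
          split_ifs
          · simp
          · rw [norm_pow]
      _ ≤ ‖y‖ ^ m := by
          rw [integral_const, smul_eq_mul]
          refine mul_le_of_le_one_left (by positivity) ?_
          rw [measureReal_restrict_apply MeasurableSet.univ]
          exact measureReal_le_one
  have h := hasSum_integral_of_summable_integral_norm hint hsum
  simp_rw [hval] at h
  convert! h using 1
  rw [← integral_const_mul]
  exact integral_congr_ae (Filter.Eventually.of_forall fun x =>
    (hasSum_pow_of_not_dvd hs (g x)).tsum_eq.symm)

end IgusaIntegral

/-! ### The number of lattices of a given type -/

section Counting

variable {p : ℕ} [Fact p.Prime]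

lemma le_primitiveVolume {n : Fin 3 → ℕ} (hn : ∃ j, n j = 0) :
    (p : ℝ)⁻¹ ^ (∑ j, n j) * (1 - (p : ℝ)⁻¹) ≤ primitiveVolume p n := by
  have hlt : ∑ j, n j < ∑ j, max (n j) 1 := by
    obtain ⟨j, hj⟩ := hn
    exact Finset.sum_lt_sum (fun i _ => le_max_left _ _) ⟨j, Finset.mem_univ _, by simp [hj]⟩
  have h := pow_le_pow_of_le_one (inv_cast_prime_pos (p := p)).le inv_cast_prime_lt_one.le
    (Nat.succ_le_of_lt hlt)
  rw [primitiveVolume, mul_sub, mul_one, ← pow_succ]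
  exact sub_le_sub_left h _

lemma ncard_hasType_le (t : ℕ × ℕ × ℕ) :
    ({Λ : Submodule ℤ_[p] (Fin 3 → ℤ_[p]) | HasType Λ t}.ncard : ℝ) ≤
      ((1 - (p : ℝ)⁻¹) ^ 2)⁻¹ * ((p : ℝ) ^ 2) ^ t.2.1 * ((p : ℝ) ^ 2) ^ t.2.2 := by
  obtain ⟨c, l, m⟩ := t
  set q := (p : ℝ)⁻¹ with hq
  have hpk : ∀ k : ℕ, ((p : ℝ) ^ 2) ^ k = ((q ^ k) ^ 2)⁻¹ := fun k => by
    rw [hq, inv_pow, inv_pow, inv_inv, pow_right_comm]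
  have hq0 : 0 < q := inv_cast_prime_pos
  have hq1 : 0 < 1 - q := sub_pos.2 inv_cast_prime_lt_one
  have h := ncard_hasType_mul_le (p := p) (c, l, m)
  have h1 := le_primitiveVolume (p := p) (n := ![0, m, m]) ⟨0, by simp⟩
  have h2 := le_primitiveVolume (p := p) (n := ![l + m, l, 0]) ⟨2, by simp⟩
  have h3 : primitiveVolume p ![0, 0, m] ≤ q ^ m := by
    rw [primitiveVolume, ← hq]
    simp only [Fin.sum_univ_three, Matrix.cons_val, zero_add]
    exact sub_le_self _ (by positivity)
  simp only [Fin.sum_univ_three, Matrix.cons_val] at h1 h2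
  rw [← hq] at h1 h2
  have h4 := (mul_le_mul_of_nonneg_left (mul_le_mul h1 h2 (by positivity)
    (primitiveVolume_pos ⟨0, by simp⟩).le) (Nat.cast_nonneg _)).trans (h.trans h3)
  rw [← le_div_iff₀ (by positivity)] at h4
  refine h4.trans (le_of_eq ?_)
  rw [hpk, hpk]
  simp only [pow_add, pow_zero, one_mul, mul_one]
  field_simp

/-- The count of lattices with dual vectors in `S`, with the volumes evaluated. The hypothesis
`m > 0` is what makes the dual vectors of each lattice a proper part of the primitive vectors. -/
lemma ncard_hasType_eq {t : ℕ × ℕ × ℕ} {S : Set (Fin 3 → ℤ_[p])} (hm : 0 < t.2.2)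
    (hS : MeasurableSet S) {A : Set (Submodule ℤ_[p] (Fin 3 → ℤ_[p]))}
    (hA : ∀ Λ ∈ A, HasType Λ t)
    (hAS : ∀ Λ, HasType Λ t → ∀ ξ ∈ dualVectors t Λ, ξ ∈ S ↔ Λ ∈ A) :
    (A.ncard : ℝ) = (if t.2.1 = 0 then 1 else 1 + (p : ℝ)⁻¹) * ((p : ℝ) ^ 2) ^ t.2.1 *
      ((p : ℝ) ^ 2) ^ t.2.2 * (padicHaar p 3).real {ξ | IsPrimitive ξ ∧ ξ ∈ S} /
        (1 - (p : ℝ)⁻¹) := by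
  have h := ncard_hasType_mul_eq hm hS hA hAS
  obtain ⟨c, l, m⟩ := t
  simp only at h hm ⊢
  set q := (p : ℝ)⁻¹ with hq
  have hpk : ∀ k : ℕ, ((p : ℝ) ^ 2) ^ k = ((q ^ k) ^ 2)⁻¹ := fun k => by
    rw [hq, inv_pow, inv_pow, inv_inv, pow_right_comm]
  have hq0 : 0 < q := inv_cast_prime_pos
  have hq1 : 1 - q ≠ 0 := (sub_pos.2 inv_cast_prime_lt_one).ne'
  have hq2 : 1 - q ^ 2 ≠ 0 := by
    have : 1 - q ^ 2 = (1 - q) * (1 + q) := by ring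
    rw [this]
    exact mul_ne_zero hq1 (by positivity)
  have hmax : max m 1 = m := max_eq_left hm
  have v1 : primitiveVolume p ![0, m, m] = q ^ (m + m) * (1 - q) := by
    simp [primitiveVolume, Fin.sum_univ_three, hmax, ← hq]
    ring
  have v3 : primitiveVolume p ![0, 0, m] = q ^ m * (1 - q ^ 2) := by
    simp [primitiveVolume, Fin.sum_univ_three, hmax, ← hq]
    ring
  rw [v1, v3] at h
  rcases Nat.eq_zero_or_pos l with rfl | hl
  · have v2 : primitiveVolume p ![0 + m, 0, 0] = q ^ m * (1 - q ^ 2) := by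
      simp [primitiveVolume, Fin.sum_univ_three, hmax, ← hq]
      ring
    rw [v2] at h
    rw [if_pos rfl, hpk, hpk]
    rw [← eq_div_iff (by positivity)] at h
    rw [h]
    simp only [pow_add, pow_zero]
    field_simp
  · have v2 : primitiveVolume p ![l + m, l, 0] = q ^ (l + m + l) * (1 - q) := by
      have h1 : max (l + m) 1 = l + m := max_eq_left (by omega)
      have h2 : max l 1 = l := max_eq_left hl
      simp [primitiveVolume, Fin.sum_univ_three, h1, h2, ← hq]
      ring
    rw [v2] at h
    rw [if_neg hl.ne', hpk, hpk]
    rw [← eq_div_iff (by positivity)] at h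
    rw [h]
    simp only [pow_add]
    field_simp
    ring

/-- Fibres of `latticeType` are sets of lattices of a given type. -/
def fibreEquiv (t : ℕ × ℕ × ℕ) :
    {Λ : FiniteIndexSublattice ℤ_[p] 3 // latticeType Λ = t} ≃
      {Λ : Submodule ℤ_[p] (Fin 3 → ℤ_[p]) | HasType Λ t} where
  toFun Λ := ⟨Λ.1.1, latticeType_eq_iff.1 Λ.2⟩
  invFun Λ := ⟨⟨Λ.1, HasType.finite Λ.2⟩, latticeType_eq_iff.2 Λ.2⟩
  left_inv _ := rfl
  right_inv _ := rfl

instance finite_fibre (t : ℕ × ℕ × ℕ) :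
    Finite {Λ : FiniteIndexSublattice ℤ_[p] 3 // latticeType Λ = t} :=
  have : Finite {Λ : Submodule ℤ_[p] (Fin 3 → ℤ_[p]) | HasType Λ t} := finite_hasType t
  Finite.of_equiv _ (fibreEquiv t).symm

lemma summable_of_summable_ncard {u : ℕ × ℕ × ℕ → ℂ}
    (hu : Summable fun t => ({Λ : Submodule ℤ_[p] (Fin 3 → ℤ_[p]) | HasType Λ t}.ncard : ℝ) *
      ‖u t‖) :
    Summable fun Λ : FiniteIndexSublattice ℤ_[p] 3 => u (latticeType Λ) := by
  rw [← summable_norm_iff, ← (Equiv.sigmaFiberEquiv latticeType).summable_iff]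
  refine (summable_sigma_of_nonneg fun _ => norm_nonneg _).2 ?_
  refine ⟨fun t => Summable.of_finite, ?_⟩
  convert! hu using 1
  funext t
  have h : ∀ Λ : {Λ : FiniteIndexSublattice ℤ_[p] 3 // latticeType Λ = t},
      ‖u (latticeType (Equiv.sigmaFiberEquiv latticeType ⟨t, Λ⟩))‖ = ‖u t‖ := by
    rintro ⟨Λ, rfl⟩; rfl
  simp only [h]
  rw [tsum_const, Nat.card_congr (fibreEquiv t), nsmul_eq_mul]
  rfl

open scoped Classical in
/-- A sum over the lattices in `A` of a function of the type, arranged by type. -/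
lemma hasSum_ncard_mul {u : ℕ × ℕ × ℕ → ℂ}
    (hu : Summable fun Λ : FiniteIndexSublattice ℤ_[p] 3 => u (latticeType Λ))
    (A : Set (Submodule ℤ_[p] (Fin 3 → ℤ_[p]))) :
    HasSum (fun t => (({Λ | HasType Λ t ∧ Λ ∈ A} :
        Set (Submodule ℤ_[p] (Fin 3 → ℤ_[p]))).ncard : ℂ) * u t)
      (∑' Λ : FiniteIndexSublattice ℤ_[p] 3, if Λ.1 ∈ A then u (latticeType Λ) else 0) := by
  have hs : Summable fun Λ : FiniteIndexSublattice ℤ_[p] 3 =>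
      if Λ.1 ∈ A then u (latticeType Λ) else 0 := by
    refine Summable.of_norm_bounded hu.norm fun Λ => ?_
    split_ifs <;> simp
  have h := (((Equiv.sigmaFiberEquiv latticeType).hasSum_iff).2 hs.hasSum).sigma
    fun t => (Summable.of_finite).hasSum
  convert! h using 1
  funext t
  have hval : ∀ Λ : {Λ : FiniteIndexSublattice ℤ_[p] 3 // latticeType Λ = t},
      (if (Equiv.sigmaFiberEquiv latticeType ⟨t, Λ⟩).1 ∈ A then
        u (latticeType (Equiv.sigmaFiberEquiv latticeType ⟨t, Λ⟩)) else 0) =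
      if (fibreEquiv t Λ).1 ∈ A then u t else 0 := by
    rintro ⟨Λ, rfl⟩; rfl
  simp only [Function.comp_apply, hval]
  have : Fintype {Λ : Submodule ℤ_[p] (Fin 3 → ℤ_[p]) | HasType Λ t} :=
    (finite_hasType t).fintype
  rw [(fibreEquiv t).tsum_eq fun Λ => if Λ.1 ∈ A then u t else 0, tsum_fintype,
    ← Finset.sum_filter, Finset.sum_const, nsmul_eq_mul]
  congr 2
  rw [← Set.ncard_coe_finset, ← Set.ncard_image_of_injective _ Subtype.val_injective]
  congr 1
  ext Λ
  simp only [Finset.coe_filter, Finset.mem_univ, true_and, Set.mem_image, Set.mem_ofPred_eq]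
  exact ⟨fun h => ⟨⟨Λ, h.1⟩, h.2, rfl⟩, by rintro ⟨⟨Λ, h⟩, h', rfl⟩; exact ⟨h, h'⟩⟩

end Counting

/-! ### Subalgebras in coordinates -/

section Transfer

variable {R : Type*} [CommRing R]

lemma HasCotype.congr {M M' : Type*} [AddCommGroup M] [Module R M] [AddCommGroup M'] [Module R M']
    (e : M ≃ₗ[R] M') {d : ℕ} {α : Fin d → ℕ} (h : HasCotype R M α) : HasCotype R M' α := by
  obtain ⟨I, h1, h2, ⟨e'⟩, h3⟩ := h
  exact ⟨I, h1, h2, ⟨e.symm.trans e'⟩, h3⟩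

lemma cotypeTerm_map {M M' : Type*} [AddCommGroup M] [Module R M] [AddCommGroup M'] [Module R M']
    (e : M ≃ₗ[R] M') {d : ℕ} (s : Fin d → ℂ) (Λ : Submodule R M) :
    cotypeTerm R s (Λ.map e.toLinearMap) = cotypeTerm R s Λ := by
  have e' := Submodule.Quotient.equiv Λ (Λ.map e.toLinearMap) e rfl
  have : HasCotype R (M' ⧸ Λ.map e.toLinearMap) = (HasCotype R (M ⧸ Λ) (d := d)) :=
    funext fun α => propext ⟨HasCotype.congr e'.symm, HasCotype.congr e'⟩
  simp only [cotypeTerm, cotype, this]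

variable {p : ℕ} [Fact p.Prime] {N : Type*} [LieRing N] [LieAlgebra ℤ_[p] N]

/-- In coordinates, finite-index subalgebras are the finite-index lattices closed under the
bracket. -/
def subalgebraEquiv (b : Module.Basis (Fin 3) ℤ_[p] N) :
    FiniteIndexSubalgebra ℤ_[p] N ≃
      {Λ : FiniteIndexSublattice ℤ_[p] 3 // IsBracketClosed b Λ.1} where
  toFun Λ := ⟨⟨Λ.1.toSubmodule.map b.equivFun.toLinearMap, by
      have := Λ.2
      exact Finite.of_equiv _ (Submodule.Quotient.equiv Λ.1.toSubmodule
        (Λ.1.toSubmodule.map b.equivFun.toLinearMap) b.equivFun rfl).toEquiv⟩, by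
      rintro u v ⟨u', hu, hu'⟩ ⟨v', hv, hv'⟩
      obtain rfl : u' = u := b.equivFun.injective hu'
      obtain rfl : v' = v := b.equivFun.injective hv'
      exact ⟨⁅u', v'⁆, Λ.1.lie_mem hu hv, rfl⟩⟩
  invFun Λ := ⟨{ toSubmodule := Λ.1.1.comap b.equivFun.toLinearMap
                 lie_mem' := fun {u v} hu hv => Λ.2 u v hu hv }, by
      have := Λ.1.2
      refine Finite.of_equiv _ (Submodule.Quotient.equiv Λ.1.1
        (Λ.1.1.comap b.equivFun.toLinearMap) b.equivFun.symm ?_).toEquiv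
      exact Submodule.map_equiv_eq_comap_symm _ _⟩
  left_inv Λ := Subtype.ext (LieSubalgebra.toSubmodule_injective
    (Submodule.comap_map_eq_of_injective b.equivFun.injective _))
  right_inv Λ := Subtype.ext (Subtype.ext
    (Submodule.map_comap_eq_of_surjective b.equivFun.surjective _))

lemma cotypeTerm_subalgebraEquiv (b : Module.Basis (Fin 3) ℤ_[p] N) (s : Fin 3 → ℂ)
    (Λ : FiniteIndexSubalgebra ℤ_[p] N) :
    cotypeTerm ℤ_[p] s (subalgebraEquiv b Λ).1.1 = cotypeTerm ℤ_[p] s Λ.1.toSubmodule :=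
  cotypeTerm_map b.equivFun s _

end Transfer

/-! ### Summation of the zeta functions -/

section ZetaFunction

lemma natCast_pow_cpow (p n : ℕ) (s : ℂ) : ((p ^ n : ℕ) : ℂ) ^ s = ((p : ℂ) ^ s) ^ n := by
  rw [← Complex.cpow_nat_mul, Complex.natCast_cpow_natCast_mul, Nat.cast_pow]

variable {p : ℕ} [Fact p.Prime]

/-- The monomial `α₁(Λ)^{-s₁} α₂(Λ)^{-s₂} α₃(Λ)^{-s₃}` of a lattice of type `(c, l, m)`. -/
def typeWeight (p : ℕ) (s₁ s₂ s₃ : ℂ) (t : ℕ × ℕ × ℕ) : ℂ :=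
  ((p : ℂ) ^ (-(s₁ + s₂ + s₃))) ^ t.1 * ((p : ℂ) ^ (-(s₁ + s₂))) ^ t.2.1 *
    ((p : ℂ) ^ (-s₁)) ^ t.2.2

lemma HasType.cotypeTerm_eq {Λ : Submodule ℤ_[p] (Fin 3 → ℤ_[p])} {t : ℕ × ℕ × ℕ}
    (h : HasType Λ t) (s₁ s₂ s₃ : ℂ) :
    cotypeTerm ℤ_[p] ![s₁, s₂, s₃] Λ = typeWeight p s₁ s₂ s₃ t := by
  have hp : (p : ℂ) ≠ 0 := cast_prime_ne_zero
  rw [cotypeTerm, h.cotype_eq, typeWeight]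
  simp only [natCast_pow_cpow, Fin.prod_univ_three, exponents, Matrix.cons_val, neg_add,
    Complex.cpow_add _ _ hp]
  ring

lemma norm_prime_cpow (s : ℂ) : ‖(p : ℂ) ^ s‖ = (p : ℝ) ^ s.re :=
  Complex.norm_natCast_cpow_of_pos (Fact.out : p.Prime).pos _

lemma norm_prime_cpow_lt_one {s : ℂ} (hs : s.re < 0) : ‖(p : ℂ) ^ s‖ < 1 := by
  rw [norm_prime_cpow]
  exact Real.rpow_lt_one_of_one_lt_of_neg one_lt_cast_prime hs

lemma sq_mul_cpow (s : ℂ) : (p : ℂ) ^ 2 * (p : ℂ) ^ (-s) = (p : ℂ) ^ (2 - s) := by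
  rw [sub_eq_add_neg, Complex.cpow_add _ _ cast_prime_ne_zero, Complex.cpow_ofNat]

variable {s₁ s₂ s₃ : ℂ}

lemma summable_ncard_mul_typeWeight (h1 : 2 < s₁.re) (h2 : 2 < (s₁ + s₂).re)
    (h3 : 0 < (s₁ + s₂ + s₃).re) :
    Summable fun t => ({Λ : Submodule ℤ_[p] (Fin 3 → ℤ_[p]) | HasType Λ t}.ncard : ℝ) *
      ‖typeWeight p s₁ s₂ s₃ t‖ := by
  set a := ‖(p : ℂ) ^ (-(s₁ + s₂ + s₃))‖
  set b := ‖(p : ℂ) ^ (2 - (s₁ + s₂))‖ with hb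
  set c := ‖(p : ℂ) ^ (2 - s₁)‖ with hc
  have ha1 : a < 1 := norm_prime_cpow_lt_one (by rw [Complex.neg_re]; linarith)
  have hb1 : b < 1 := norm_prime_cpow_lt_one (by rw [Complex.sub_re, Complex.re_ofNat]; linarith)
  have hc1 : c < 1 := norm_prime_cpow_lt_one (by rw [Complex.sub_re, Complex.re_ofNat]; linarith)
  have hgeo : Summable fun t : ℕ × ℕ × ℕ => a ^ t.1 * (b ^ t.2.1 * c ^ t.2.2) :=
    (summable_geometric_of_lt_one (norm_nonneg _) ha1).mul_of_nonneg
      ((summable_geometric_of_lt_one (norm_nonneg _) hb1).mul_of_nonneg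
        (summable_geometric_of_lt_one (norm_nonneg _) hc1)
        (fun _ => pow_nonneg (norm_nonneg _) _) (fun _ => pow_nonneg (norm_nonneg _) _))
      (fun _ => pow_nonneg (norm_nonneg _) _)
      (fun _ => mul_nonneg (pow_nonneg (norm_nonneg _) _) (pow_nonneg (norm_nonneg _) _))
  refine Summable.of_nonneg_of_le (fun t => by positivity) (fun t => ?_)
    (hgeo.mul_left ((1 - (p : ℝ)⁻¹) ^ 2)⁻¹)
  refine (mul_le_mul_of_nonneg_right (ncard_hasType_le t) (norm_nonneg _)).trans (le_of_eq ?_)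
  rw [hb, hc, ← sq_mul_cpow, ← sq_mul_cpow]
  simp only [typeWeight, norm_mul, norm_pow, Complex.norm_natCast, a]
  ring

lemma summable_typeWeight (h1 : 2 < s₁.re) (h2 : 2 < (s₁ + s₂).re)
    (h3 : 0 < (s₁ + s₂ + s₃).re) :
    Summable fun Λ : FiniteIndexSublattice ℤ_[p] 3 => typeWeight p s₁ s₂ s₃ (latticeType Λ) :=
  summable_of_summable_ncard (summable_ncard_mul_typeWeight h1 h2 h3)

/-- The lattices of type `(c, l, m)` that are not subalgebras are counted by the measure of the
set of primitive vectors at which `p ^ c f` is not divisible by `p ^ m`. -/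
lemma ncard_not_isBracketClosed {N : Type*} [LieRing N] [LieAlgebra ℤ_[p] N]
    (b : Module.Basis (Fin 3) ℤ_[p] N) (t : ℕ × ℕ × ℕ) :
    (({Λ | HasType Λ t ∧ Λ ∈ {Λ | ¬ IsBracketClosed b Λ}} :
      Set (Submodule ℤ_[p] (Fin 3 → ℤ_[p]))).ncard : ℝ) =
      (if t.2.1 = 0 then 1 else 1 + (p : ℝ)⁻¹) * ((p : ℝ) ^ 2) ^ t.2.1 *
      ((p : ℝ) ^ 2) ^ t.2.2 * (padicHaar p 3).real {ξ | IsPrimitive ξ ∧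
        ξ ∈ {ξ | ¬ (p : ℤ_[p]) ^ t.2.2 ∣ (p : ℤ_[p]) ^ t.1 * basisForm b ξ}} /
        (1 - (p : ℝ)⁻¹) := by
  rcases Nat.eq_zero_or_pos t.2.2 with hm | hm
  · have hempty : ({Λ | HasType Λ t ∧ Λ ∈ {Λ | ¬ IsBracketClosed b Λ}} :
        Set (Submodule ℤ_[p] (Fin 3 → ℤ_[p]))) = ∅ := by
      refine Set.eq_empty_of_forall_notMem fun Λ hΛ => hΛ.2 ?_
      have hpos : 0 < (padicHaar p 3).real (dualVectors t Λ) := by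
        rw [measureReal_dualVectors hΛ.1]
        exact primitiveVolume_pos ⟨0, rfl⟩
      obtain ⟨ξ, hξ⟩ : (dualVectors t Λ).Nonempty := by
        by_contra hne
        rw [Set.not_nonempty_iff_eq_empty.1 hne] at hpos
        simp at hpos
      rw [hΛ.1.isBracketClosed_iff hξ, hm, pow_zero]
      exact one_dvd _
    rw [hempty, hm]
    simp
  · refine ncard_hasType_eq hm ?_ (fun Λ h => h.1) fun Λ hΛ ξ hξ => ?_
    · exact ((isClosed_setOf_pow_dvd t.2.2).preimage
        (continuous_const.mul (continuous_basisForm b))).measurableSet.compl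
    · simp only [Set.mem_ofPred_eq, hΛ, true_and, hΛ.isBracketClosed_iff hξ]

/-- The factor `1 + q` is absent for `l = 0`, where the hyperplane lattice determines the lattice up
to scaling. -/
lemma hasSum_ite_mul_pow {q z : ℂ} (hz : ‖z‖ < 1) :
    HasSum (fun l : ℕ => (if l = 0 then 1 else 1 + q) * z ^ l) ((1 + q * z) / (1 - z)) := by
  have hz1 : 1 - z ≠ 0 := by
    rw [sub_ne_zero]
    rintro rfl
    simp at hz
  have h := (hasSum_geometric_of_norm_lt_one hz).mul_left ((1 + q) * z)
  rw [← hasSum_nat_add_iff' 1]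
  convert! h using 1
  · funext l
    rw [if_neg (Nat.succ_ne_zero l)]
    ring
  · simp
    field_simp
    ring

/-- The part of the zeta function of `ℤ_p ^ 3` coming from lattices that are not subalgebras. -/
lemma tsum_ncard_mul_typeWeight {N : Type*} [LieRing N] [LieAlgebra ℤ_[p] N]
    (b : Module.Basis (Fin 3) ℤ_[p] N) (h1 : 2 < s₁.re) (h2 : 2 < (s₁ + s₂).re)
    (h3 : 0 < (s₁ + s₂ + s₃).re)
    (hsum : Summable fun t => (({Λ | HasType Λ t ∧ Λ ∈ {Λ | ¬ IsBracketClosed b Λ}} :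
      Set (Submodule ℤ_[p] (Fin 3 → ℤ_[p]))).ncard : ℂ) * typeWeight p s₁ s₂ s₃ t) :
    ∑' t, (({Λ | HasType Λ t ∧ Λ ∈ {Λ | ¬ IsBracketClosed b Λ}} :
      Set (Submodule ℤ_[p] (Fin 3 → ℤ_[p]))).ncard : ℂ) * typeWeight p s₁ s₂ s₃ t =
    igusaZeta p (basisForm b) (s₁ - 2) * (p : ℂ) ^ (2 - s₁) * (1 + (p : ℂ) ^ (1 - s₁ - s₂)) *
        (1 - (p : ℂ) ^ (1 - 2 * s₁)) /
      ((1 - (p : ℂ) ^ (2 - s₁)) * (1 - (p : ℂ) ^ (2 - s₁ - s₂)) *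
        (1 - (p : ℂ) ^ (2 - 2 * s₁ - s₂ - s₃)) * (1 - (p : ℂ)⁻¹)) := by
  have hp : (p : ℂ) ≠ 0 := cast_prime_ne_zero
  have hs : 0 < (s₁ - 2).re := by rw [Complex.sub_re, Complex.re_ofNat]; linarith
  set y := (p : ℂ) ^ (2 - s₁) with hy
  have hyneg : (p : ℂ) ^ (-(s₁ - 2)) = y := by rw [neg_sub]
  set z := (p : ℂ) ^ (2 - (s₁ + s₂)) with hz
  have hz1 : ‖z‖ < 1 := norm_prime_cpow_lt_one (by rw [Complex.sub_re, Complex.re_ofNat]; linarith)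
  set w := (p : ℂ) ^ (-(s₁ + s₂ + s₃)) with hw
  set I := ∫ x in {x | IsPrimitive x}, ((‖basisForm b x‖ : ℝ) : ℂ) ^ (s₁ - 2) ∂(padicHaar p 3)
    with hI
  have hwy : w * y = (p : ℂ) ^ (2 - 2 * s₁ - s₂ - s₃) := by
    rw [hw, hy, ← Complex.cpow_add _ _ hp]
    congr 1
    ring
  have hwy1 : ‖w * y‖ < 1 := by
    rw [hwy]
    refine norm_prime_cpow_lt_one ?_
    simp only [Complex.sub_re, Complex.add_re, Complex.mul_re, Complex.re_ofNat, Complex.im_ofNat]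
      at h1 h2 h3 ⊢
    linarith
  set D : ℕ → ℕ → ℂ := fun c m => y ^ m * ((padicHaar p 3).real {ξ | IsPrimitive ξ ∧
    ξ ∈ {ξ | ¬ (p : ℤ_[p]) ^ m ∣ (p : ℤ_[p]) ^ c * basisForm b ξ}} : ℂ) with hD
  have hDsum : ∀ c, HasSum (D c) (y / (1 - y) * (y ^ c * I)) := by
    intro c
    have h := hasSum_measureReal_not_dvd
      (g := fun ξ => (p : ℤ_[p]) ^ c * basisForm b ξ)
      (continuous_const.mul (continuous_basisForm b)) hs
    simp_rw [norm_mul_cpow, norm_prime_pow_cpow, hyneg] at h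
    rw [integral_const_mul] at h
    exact h
  have hterm : ∀ t : ℕ × ℕ × ℕ, (({Λ | HasType Λ t ∧ Λ ∈ {Λ | ¬ IsBracketClosed b Λ}} :
      Set (Submodule ℤ_[p] (Fin 3 → ℤ_[p]))).ncard : ℂ) * typeWeight p s₁ s₂ s₃ t =
      (1 - (p : ℂ)⁻¹)⁻¹ * w ^ t.1 * (((if t.2.1 = 0 then 1 else 1 + (p : ℂ)⁻¹) * z ^ t.2.1) *
        D t.1 t.2.2) := by
    intro t
    have h := congrArg (fun r : ℝ => (r : ℂ)) (ncard_not_isBracketClosed b t)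
    simp only [Complex.ofReal_natCast] at h
    rw [h, typeWeight, hD, hz, hy, ← sq_mul_cpow, ← sq_mul_cpow, hw]
    split_ifs <;> push_cast <;> ring
  have hsum' := hsum
  simp_rw [hterm] at hsum' ⊢
  have hc : ∀ c, ∑' lm : ℕ × ℕ, (1 - (p : ℂ)⁻¹)⁻¹ * w ^ c *
      (((if lm.1 = 0 then 1 else 1 + (p : ℂ)⁻¹) * z ^ lm.1) * D c lm.2) =
      (1 - (p : ℂ)⁻¹)⁻¹ * ((1 + (p : ℂ)⁻¹ * z) / (1 - z)) * (y / (1 - y) * I) * (w * y) ^ c := by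
    intro c
    rw [(hsum'.prod_factor c).tsum_prod]
    have hl : ∀ l : ℕ, ∑' m : ℕ, (1 - (p : ℂ)⁻¹)⁻¹ * w ^ c *
        (((if l = 0 then 1 else 1 + (p : ℂ)⁻¹) * z ^ l) * D c m) =
        (1 - (p : ℂ)⁻¹)⁻¹ * w ^ c * (((if l = 0 then 1 else 1 + (p : ℂ)⁻¹) * z ^ l) *
          (y / (1 - y) * (y ^ c * I))) := fun l =>
      (((hDsum c).mul_left _).mul_left _).tsum_eq
    rw [tsum_congr hl, (((hasSum_ite_mul_pow hz1).mul_right _).mul_left _).tsum_eq]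
    ring
  rw [hsum'.tsum_prod]
  rw [tsum_congr hc, tsum_mul_left, (hasSum_geometric_of_norm_lt_one hwy1).tsum_eq, hwy]
  have hIZ := setIntegral_isPrimitive_eq_igusaZeta_mul (basisForm b) (continuous_basisForm b) hs
  rw [← hI, hyneg] at hIZ
  have hy2 : (p : ℂ)⁻¹ ^ 3 * y ^ 2 = (p : ℂ) ^ (1 - 2 * s₁) := by
    have e : (1 - 2 * s₁ : ℂ) = ((-3 : ℤ) : ℂ) + (2 - s₁) + (2 - s₁) := by push_cast; ring
    rw [e, Complex.cpow_add _ _ hp, Complex.cpow_add _ _ hp, Complex.cpow_intCast, ← hy]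
    rw [zpow_neg, inv_pow]
    norm_cast
    ring
  have hqz : (p : ℂ)⁻¹ * z = (p : ℂ) ^ (1 - s₁ - s₂) := by
    have e : (1 - s₁ - s₂ : ℂ) = ((-1 : ℤ) : ℂ) + (2 - (s₁ + s₂)) := by push_cast; ring
    rw [e, Complex.cpow_add _ _ hp, Complex.cpow_intCast, ← hz, zpow_neg_one]
  rw [hIZ, hy2, hqz, show (2 - s₁ - s₂ : ℂ) = 2 - (s₁ + s₂) by ring, ← hz]
  simp only [div_eq_mul_inv, mul_inv]
  ring

open scoped Classical in
/-- The zeta function of a Lie algebra with a basis, in terms of the form attached to this basis. -/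
lemma subalgebraCotypeZeta_eq {N : Type*} [LieRing N] [LieAlgebra ℤ_[p] N]
    (b : Module.Basis (Fin 3) ℤ_[p] N) (h1 : 2 < s₁.re) (h2 : 2 < (s₁ + s₂).re)
    (h3 : 0 < (s₁ + s₂ + s₃).re) :
    Summable (fun Λ : FiniteIndexSublattice ℤ_[p] 3 => cotypeTerm ℤ_[p] ![s₁, s₂, s₃] Λ.1) ∧
    Summable (fun Λ : FiniteIndexSubalgebra ℤ_[p] N =>
      cotypeTerm ℤ_[p] ![s₁, s₂, s₃] Λ.1.toSubmodule) ∧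
    subalgebraCotypeZeta ℤ_[p] N ![s₁, s₂, s₃] =
      latticeCotypeZeta ℤ_[p] ![s₁, s₂, s₃] -
    igusaZeta p (basisForm b) (s₁ - 2) * (p : ℂ) ^ (2 - s₁) * (1 + (p : ℂ) ^ (1 - s₁ - s₂)) *
        (1 - (p : ℂ) ^ (1 - 2 * s₁)) /
      ((1 - (p : ℂ) ^ (2 - s₁)) * (1 - (p : ℂ) ^ (2 - s₁ - s₂)) *
        (1 - (p : ℂ) ^ (2 - 2 * s₁ - s₂ - s₃)) * (1 - (p : ℂ)⁻¹)) := by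
  have hterm : ∀ Λ : FiniteIndexSublattice ℤ_[p] 3,
      cotypeTerm ℤ_[p] ![s₁, s₂, s₃] Λ.1 = typeWeight p s₁ s₂ s₃ (latticeType Λ) :=
    fun Λ => (hasType_latticeType Λ).cotypeTerm_eq s₁ s₂ s₃
  have hS := summable_typeWeight (p := p) h1 h2 h3
  have hsub : ∀ Λ : FiniteIndexSubalgebra ℤ_[p] N,
      cotypeTerm ℤ_[p] ![s₁, s₂, s₃] Λ.1.toSubmodule =
        typeWeight p s₁ s₂ s₃ (latticeType (subalgebraEquiv b Λ).1) := by
    intro Λ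
    rw [← cotypeTerm_subalgebraEquiv b, hterm]
  have hbad := hasSum_ncard_mul hS {Λ | ¬ IsBracketClosed b Λ}
  have hbadval := (hbad.tsum_eq).symm.trans
    (tsum_ncard_mul_typeWeight b h1 h2 h3 hbad.summable)
  refine ⟨by simpa only [hterm] using hS, ?_, ?_⟩
  · simp only [hsub]
    exact hS.comp_injective (Subtype.val_injective.comp (subalgebraEquiv b).injective)
  · rw [← hbadval, subalgebraCotypeZeta, latticeCotypeZeta]
    simp only [hsub, hterm]
    rw [(subalgebraEquiv b).tsum_eq fun Λ => typeWeight p s₁ s₂ s₃ (latticeType Λ.1)]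
    have hind : ∑' Λ : {Λ : FiniteIndexSublattice ℤ_[p] 3 // IsBracketClosed b Λ.1},
        typeWeight p s₁ s₂ s₃ (latticeType Λ.1) = _ :=
      tsum_subtype {Λ : FiniteIndexSublattice ℤ_[p] 3 | IsBracketClosed b Λ.1}
        fun Λ => typeWeight p s₁ s₂ s₃ (latticeType Λ)
    rw [hind, eq_sub_iff_add_eq, ← Summable.tsum_add]
    · refine tsum_congr fun Λ => ?_
      by_cases h : IsBracketClosed b Λ.1 <;> simp [Set.indicator, h]
    · exact hS.indicator _
    · refine Summable.of_norm_bounded hS.norm fun Λ => ?_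
      split_ifs <;> simp

end ZetaFunction

end CotypeZeta

end

theorem theorem1p6 (p : ℕ) [Fact p.Prime]
    (L : Type*) [LieRing L] [LieAlgebra ℤ_[p] L] [Module.Free ℤ_[p] L]
    (hL : Module.finrank ℤ_[p] L = 3) :
    (∃ f : QuadraticForm ℤ_[p] (Fin 3 → ℤ_[p]), CotypeZeta.IsAttachedForm L f) ∧
    (∀ f g : QuadraticForm ℤ_[p] (Fin 3 → ℤ_[p]), CotypeZeta.IsAttachedForm L f →
      (CotypeZeta.IsAttachedForm L g ↔ CotypeZeta.FormEquiv f g)) ∧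
    (∀ f : QuadraticForm ℤ_[p] (Fin 3 → ℤ_[p]), CotypeZeta.IsAttachedForm L f →
      ∀ (i : ℕ) (s₁ s₂ s₃ : ℂ),
        2 < s₁.re → 2 < (s₁ + s₂).re → 0 < (s₁ + s₂ + s₃).re →
        MeasureTheory.Integrable (fun x => ((‖f x‖ : ℝ) : ℂ) ^ (s₁ - 2))
          (CotypeZeta.padicHaar p 3) ∧
        Summable (fun Λ : CotypeZeta.FiniteIndexSublattice ℤ_[p] 3 =>
          CotypeZeta.cotypeTerm ℤ_[p] ![s₁, s₂, s₃] Λ.1) ∧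
        Summable (fun Λ : CotypeZeta.FiniteIndexSubalgebra ℤ_[p]
            (CotypeZeta.scaled ((p : ℤ_[p]) ^ i) L) =>
          CotypeZeta.cotypeTerm ℤ_[p] ![s₁, s₂, s₃] Λ.1.toSubmodule) ∧
        CotypeZeta.subalgebraCotypeZeta ℤ_[p]
            (CotypeZeta.scaled ((p : ℤ_[p]) ^ i) L) ![s₁, s₂, s₃] =
          CotypeZeta.latticeCotypeZeta ℤ_[p] ![s₁, s₂, s₃] -
            CotypeZeta.igusaZeta p f (s₁ - 2) * ((p : ℂ) ^ (2 - s₁)) ^ (i + 1) *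
                (1 + (p : ℂ) ^ (1 - s₁ - s₂)) * (1 - (p : ℂ) ^ (1 - 2 * s₁)) /
              ((1 - (p : ℂ) ^ (2 - s₁)) * (1 - (p : ℂ) ^ (2 - s₁ - s₂)) *
                (1 - (p : ℂ) ^ (2 - 2 * s₁ - s₂ - s₃)) * (1 - (p : ℂ)⁻¹))) := by
  refine ⟨?_, fun f g hf => CotypeZeta.isAttachedForm_iff_formEquiv hf, ?_⟩
  · have : Module.Finite ℤ_[p] L := Module.finite_of_finrank_pos (by omega)
    exact ⟨_, Module.finBasisOfFinrankEq ℤ_[p] L hL, rfl⟩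
  · rintro f ⟨b, rfl⟩ i s₁ s₂ s₃ h1 h2 h3
    have hs : 0 < (s₁ - 2).re := by rw [Complex.sub_re, Complex.re_ofNat]; linarith
    obtain ⟨hS, hS', hZ⟩ := CotypeZeta.subalgebraCotypeZeta_eq
      (CotypeZeta.scaledBasis b (CotypeZeta.p_pow_ne_zero (p := p) i)) h1 h2 h3
    refine ⟨CotypeZeta.integrable_norm_cpow (CotypeZeta.continuous_basisForm b) hs, hS, hS', ?_⟩
    have hscale : CotypeZeta.igusaZeta p
        (CotypeZeta.basisForm (CotypeZeta.scaledBasis b (CotypeZeta.p_pow_ne_zero (p := p) i)))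
          (s₁ - 2) =
        ((p : ℂ) ^ (2 - s₁)) ^ i * CotypeZeta.igusaZeta p (CotypeZeta.basisForm b) (s₁ - 2) := by
      simp only [CotypeZeta.igusaZeta, CotypeZeta.basisForm_scaledBasis, CotypeZeta.norm_mul_cpow,
        CotypeZeta.norm_prime_pow_cpow, neg_sub]
      rw [MeasureTheory.integral_const_mul]
    rw [hZ, hscale]
    ring
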